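/- **Corollary (rectilinear planar drawings with horizontal lengths).** Let $G$ be a finite connected simple plane graph of maximum degree at most $4$ (given by the counterclockwise cyclic order of the edges around each vertex, of genus $0$). Suppose every angle (corner) of $G$, i.e. every pair of consecutive edges around a vertex, is assigned an integer multiple of $90^\circ$ such that the angles at each vertex incident to an edge sum to $360^\circ$ (so the angle at a vertex of degree $1$ is $360^\circ$), each edge is designated as horizontal or vertical, and a length is assigned to every horizontal edge. The cycles of $G$ are its face cycles: the closed boundary walks of the faces (if a walk is not a simple cycle, a repeated vertex or edge is drawn once). A rectilinear planar drawing of $G$, or of the boundary of a face, draws its vertices as distinct points, its horizontal (vertical) edges as horizontal (vertical) line segments, with no edge through another vertex and no two distinct edges meeting except at common endpoints. It realizes the data if the horizontal edges have the assigned lengths and all angles of $G$, respectively all angles of that face, have the assigned values. 1. $G$ has a rectilinear planar drawing realizing the angles and lengths if and only if every face cycle of $G$ has a rectilinear planar drawing realizing its angles and lengths. 2. Moreover, drawings of the faces can be combined: given, for every face $F$, a rectilinear planar drawing $D_F$ of its face cycle realizing the angles and lengths, such that every vertical edge has the same length in the drawings of the two faces on its two sides, there is a rectilinear planar drawing of $G$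 realizing the angles and lengths whose restriction to the boundary of each face $F$ is $D_F$ up to a translation and possibly a half-turn. In particular, the vertical visibilities inside each face are those of $D_F$. -/

import Mathlib

/-- A combinatorial embedding of a graph in an oriented surface: `rot d` is the dart that follows
the dart `d` in the counterclockwise order around the vertex `d.fst`. -/
structure RotationSystem {V : Type*} (G : SimpleGraph V) where
  /-- the counterclockwise successor of a dart around its tail -/
  rot : Equiv.Perm G.Dart
  rot_fst : ∀ d, (rot d).fst = d.fst
  rot_sameCycle : ∀ d e, d.fst = e.fst → rot.SameCycle d e

namespace RotationSystem

variable {V : Type*} {G : SimpleGraph V}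

/-- The face permutation. Walking along `d` with the face on the left, the boundary walk of the
face continues at the head of `d` with the dart that precedes `d.symm` counterclockwise. -/
def faceNext (R : RotationSystem G) : Equiv.Perm G.Dart :=
  R.rot⁻¹ * Function.Involutive.toPerm _ (SimpleGraph.Dart.symm_involutive (G := G))

/-- The faces (with nonempty boundary): the cycles of the face permutation. Each dart lies on
exactly one face, the one to its left, so each edge lies on two faces, which coincide for a
bridge. -/
def Face (R : RotationSystem G) : Type _ :=
  Quotient (Equiv.Perm.SameCycle.setoid R.faceNext)

/-- The face to the left of a dart. -/
def faceOf (R : RotationSystem G) (d : G.Dart) : R.Face :=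
  Quotient.mk (Equiv.Perm.SameCycle.setoid R.faceNext) d

/-- The darts of the boundary walk of a face. A dart `d` of the face stands also for the corner of
the face between `d` and `R.rot d` at the vertex `d.fst`. -/
def Face.darts {R : RotationSystem G} (F : R.Face) : Set G.Dart :=
  {d | R.faceOf d = F}

/-- The boundary of a face, as a subgraph: the vertices and edges of its boundary walk. -/
def Face.boundary {R : RotationSystem G} (F : R.Face) : G.Subgraph where
  verts := {v | ∃ d ∈ F.darts, v ∈ d.edge}
  Adj a b := ∃ d ∈ F.darts, d.edge = s(a, b)
  adj_sub := by
    rintro a b ⟨d, -, h⟩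
    have h2 := d.edge_mem
    rwa [h] at h2
  edge_vert := by
    rintro a b ⟨d, hd, h⟩
    exact ⟨d, hd, by simp [h]⟩
  symm := ⟨by
    rintro a b ⟨d, hd, h⟩
    exact ⟨d, hd, by rw [h, Sym2.eq_swap]⟩⟩

/-- The embedding has genus zero, i.e. it is an embedding in the plane: Euler's formula
`#V - #E + #F = 2` holds for every connected component, summed up over the components (a component
has Euler characteristic at most `2`). An isolated vertex has one face, which contains no dart and
is counted separately. -/
def IsPlane (R : RotationSystem G) : Prop :=
  Nat.card V + (Nat.card R.Face + {v : V | ∀ w, ¬ G.Adj v w}.ncard)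
    = Nat.card G.edgeSet + 2 * Nat.card G.ConnectedComponent

end RotationSystem

/-- The map `p` of the vertices to the plane `ℂ` gives a planar straight-line drawing of the
subgraph `H`: distinct vertices are distinct points, no edge passes through a vertex, and distinct
edges do not meet except at common endpoints. Values of `p` outside `H` are irrelevant. -/
structure IsPlanarDrawing {V : Type*} {G : SimpleGraph V} (H : G.Subgraph) (p : V → ℂ) :
    Prop where
  injOn : Set.InjOn p H.verts
  notMem_edge : ∀ a b v, H.Adj a b → v ∈ H.verts → p v ∉ openSegment ℝ (p a) (p b)
  disjoint : ∀ a b c d, H.Adj a b → H.Adj c d → s(a, b) ≠ s(c, d) →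
    Disjoint (openSegment ℝ (p a) (p b)) (openSegment ℝ (p c) (p d))

/-- `p` is a rectilinear planar drawing of the subgraph `H`, with the edges in `hor` drawn as
horizontal segments of the lengths `len` and all other edges drawn as vertical segments, which
realizes the angles at the corners in `C`: turning the edge `d` counterclockwise around `d.fst`
through `angle d` right angles gives the direction of the next edge `R.rot d`. -/
structure IsRectilinearDrawing {V : Type*} {G : SimpleGraph V} (R : RotationSystem G)
    (angle : G.Dart → ℕ) (hor : Set (Sym2 V)) (len : Sym2 V → ℝ)
    (H : G.Subgraph) (C : Set G.Dart) (p : V → ℂ) : Prop where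
  planar : IsPlanarDrawing H p
  horizontal : ∀ a b, H.Adj a b → s(a, b) ∈ hor →
    (p a).im = (p b).im ∧ |(p a).re - (p b).re| = len s(a, b)
  vertical : ∀ a b, H.Adj a b → s(a, b) ∉ hor → (p a).re = (p b).re
  angles : ∀ d ∈ C, ∃ c : ℝ, 0 < c ∧
    p (R.rot d).snd - p d.fst = (c : ℂ) * Complex.I ^ angle d * (p d.snd - p d.fst)

/-- `p` is a rectilinear planar drawing of the whole plane graph. -/
def DrawsGraph {V : Type*} {G : SimpleGraph V} (R : RotationSystem G)
    (angle : G.Dart → ℕ) (hor : Set (Sym2 V)) (len : Sym2 V → ℝ) (p : V → ℂ) : Prop :=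
  IsRectilinearDrawing R angle hor len ⊤ Set.univ p

/-- `p` is a rectilinear planar drawing of the boundary cycle (closed boundary walk) of the
face `F`, realizing the angles of `F` and the horizontal lengths. -/
def DrawsFace {V : Type*} {G : SimpleGraph V} (R : RotationSystem G)
    (angle : G.Dart → ℕ) (hor : Set (Sym2 V)) (len : Sym2 V → ℝ) (F : R.Face) (p : V → ℂ) :
    Prop :=
  IsRectilinearDrawing R angle hor len F.boundary F.darts p

set_option linter.unusedSectionVars false

/-! A drawing of the graph restricts to its faces. For the converse, two potentials first bring the
face drawings into a common frame. The vertex-edge and face-edge incidence matrices are composable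
and, by connectedness, the kernels of their transposes contain only constants. Euler's formula
therefore makes the sequence exact over every field (`Matrix.exists_transpose_mulVec_eq`). Over
`ZMod 2`: the two drawings of an edge, in the faces on its two sides, point in the same direction up
to a half-turn. These discrepancies add up to zero around a vertex because its angles sum to four
right angles, so some of the face drawings can be turned to make all directions agree
(`IsPlane.exists_dir`). Over `ℝ`: the horizontal displacements now agree and add up to zero around
each face, so all faces can share their abscissae (`IsPlane.exists_coordinate`). If the vertical
lengths agree, the same argument gives common ordinates.

It remains to see that the faces fit together without crossings; this is done on vertical lines. The
places of a line are the vertices on it and the horizontal edges crossing it. A winding number in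
the drawing of a face `F` shows that, below a place with `F` under it, the next place of `F` has `F`
above it (`upper_of_lower`). Hence every place has a unique predecessor, unless only an unbounded
part of a face is below it; successors are unique too. Locally this does not exclude several chains,
or a cycle, on one line. But being reachable from the bottom place of a fixed face is preserved when
the line moves (`Transition`), hence along all edges. It holds at a leftmost vertex, so by
connectedness the places of every line form one chain above one bottom place.

The chain order of two maximal horizontal segments is the same on all lines meeting both. The
segments project to intervals, and heights increasing along all chains are found by inserting the
intervals by their left ends (`exists_height_of_intervals`). Any such heights give a planar drawing
(`Valid.isPlanarDrawing`). When the ordinates are common to all faces they already increase along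
the chains, since each covering step takes place in a single face drawing; this keeps the given
drawings. -/

/-! ### Exactness from a dimension count -/

theorem Matrix.card_le_rank_transpose_add_one {K C E : Type*} [Field K] [Fintype C] [Fintype E]
    (P : Matrix C E K) (hP : ∀ f : C → K, P.transpose.mulVec f = 0 → ∃ c, f = fun _ => c) :
    Fintype.card C ≤ P.transpose.rank + 1 := by
  classical
  have h1 := P.transpose.mulVecLin.finrank_range_add_finrank_ker
  have h2 : LinearMap.ker P.transpose.mulVecLin ≤ Submodule.span K {fun _ => (1 : K)} := by
    intro f hf
    obtain ⟨c, rfl⟩ := hP f (by rwa [LinearMap.mem_ker, Matrix.mulVecLin_apply] at hf)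
    exact Submodule.mem_span_singleton.2 ⟨c, by ext; simp⟩
  have h3 := (Submodule.finrank_mono h2).trans (finrank_span_le_card _)
  simp only [Set.toFinset_singleton, Finset.card_singleton, Module.finrank_fintype_fun_eq_card]
    at h1 h3
  rw [Matrix.rank]
  omega

/-- If two composable incidence matrices have corank at most one each and the Euler
characteristic is two, then the sequence they form is exact. -/
theorem Matrix.exists_transpose_mulVec_eq {K A B E : Type*} [Field K] [Fintype A] [Fintype B]
    [Fintype E] (M : Matrix A E K) (N : Matrix B E K) (hNM : N * M.transpose = 0)
    (hM : ∀ f : A → K, M.transpose.mulVec f = 0 → ∃ c, f = fun _ => c)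
    (hN : ∀ f : B → K, N.transpose.mulVec f = 0 → ∃ c, f = fun _ => c)
    (hcard : Fintype.card A + Fintype.card B = Fintype.card E + 2)
    (δ : E → K) (hδ : N.mulVec δ = 0) : ∃ p, M.transpose.mulVec p = δ := by
  have hle : LinearMap.range M.transpose.mulVecLin ≤ LinearMap.ker N.mulVecLin := by
    rintro _ ⟨p, rfl⟩
    rw [LinearMap.mem_ker, Matrix.mulVecLin_apply, Matrix.mulVecLin_apply, Matrix.mulVec_mulVec,
      hNM, Matrix.zero_mulVec]
  have heq : LinearMap.range M.transpose.mulVecLin = LinearMap.ker N.mulVecLin := by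
    -- The range of the transpose of `M` has dimension at least `|A| - 1`, and the kernel of `N` at
    -- most `|E| - (|B| - 1) = |A| - 1`.
    apply Submodule.eq_of_le_of_finrank_le hle
    have h1 := N.mulVecLin.finrank_range_add_finrank_ker
    have h2 := M.card_le_rank_transpose_add_one hM
    have h3 := N.card_le_rank_transpose_add_one hN
    rw [Matrix.rank_transpose] at h3
    rw [Matrix.rank] at h2 h3
    simp only [Module.finrank_fintype_fun_eq_card] at h1
    omega
  have : δ ∈ LinearMap.ker N.mulVecLin := by rwa [LinearMap.mem_ker, Matrix.mulVecLin_apply]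
  rw [← heq] at this
  obtain ⟨p, hp⟩ := this
  exact ⟨p, by rwa [Matrix.mulVecLin_apply] at hp⟩

namespace SimpleGraph

variable {V : Type*} [Fintype V] [DecidableEq V] {G : SimpleGraph V} [DecidableRel G.Adj]

/-- One of the two darts of an edge. -/
noncomputable def edgeDart (e : G.edgeSet) : G.Dart :=
  (Sym2.ind (f := fun z => z ∈ G.edgeSet → ∃ d : G.Dart, d.edge = z)
    (fun a b h => ⟨⟨(a, b), h⟩, rfl⟩) e.1 e.2).choose

theorem edge_edgeDart (e : G.edgeSet) : (edgeDart e).edge = e :=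
  (Sym2.ind (f := fun z => z ∈ G.edgeSet → ∃ d : G.Dart, d.edge = z)
    (fun a b h => ⟨⟨(a, b), h⟩, rfl⟩) e.1 e.2).choose_spec

theorem sum_edgeDart {K : Type*} [AddCommMonoid K] (a : G.Dart → K) :
    ∑ e : G.edgeSet, (a (edgeDart e) + a (edgeDart e).symm) = ∑ d, a d := by
  rw [← Finset.sum_fiberwise Finset.univ (fun d : G.Dart => (⟨d.edge, d.edge_mem⟩ : G.edgeSet)) a]
  refine Finset.sum_congr rfl fun e _ => ?_
  have : ({d : G.Dart | (⟨d.edge, d.edge_mem⟩ : G.edgeSet) = e} : Finset G.Dart)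
      = {edgeDart e, (edgeDart e).symm} := by
    ext d
    rw [Finset.mem_filter]
    simp only [Finset.mem_univ, true_and, Finset.mem_insert, Finset.mem_singleton]
    rw [← dart_edge_eq_iff, edge_edgeDart, Subtype.ext_iff]
  rw [this, Finset.sum_pair (Dart.symm_ne _).symm]

theorem eq_edgeDart_or (d : G.Dart) :
    ∃ e : G.edgeSet, d = edgeDart e ∨ d = (edgeDart e).symm :=
  ⟨⟨d.edge, d.edge_mem⟩, by rw [← dart_edge_eq_iff, edge_edgeDart]⟩

end SimpleGraph

/-! ### Vertex and face potentials on a connected plane graph -/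

namespace RotationSystem

open SimpleGraph

variable {V : Type*} {G : SimpleGraph V}

theorem faceOf_faceNext (R : RotationSystem G) (d : G.Dart) :
    R.faceOf (R.faceNext d) = R.faceOf d :=
  Quotient.sound (s := Equiv.Perm.SameCycle.setoid R.faceNext)
    (Equiv.Perm.sameCycle_apply_left.2 (Equiv.Perm.SameCycle.refl _ _))

/-- The boundary walk arriving along `(R.rot d).symm` continues with `d`: the corner between `d` and
`R.rot d` lies to the left of one and to the right of the other. -/
theorem faceOf_symm_rot (R : RotationSystem G) (d : G.Dart) :
    R.faceOf (R.rot d).symm = R.faceOf d := by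
  rw [← R.faceOf_faceNext (R.rot d).symm]
  simp [faceNext]

theorem faceNext_fst (R : RotationSystem G) (d : G.Dart) : (R.faceNext d).fst = d.snd := by
  have := R.rot_fst (R.faceNext d)
  simp only [faceNext, Equiv.Perm.coe_mul, Function.comp_apply, Equiv.Perm.coe_inv, Equiv.apply_symm_apply,
    Function.Involutive.coe_toPerm] at this
  simpa [faceNext] using this.symm

theorem eq_of_fst_eq (R : RotationSystem G) {α : Type*} (f : G.Dart → α)
    (hf : ∀ d, f (R.rot d) = f d) {d e : G.Dart} (h : d.fst = e.fst) : f d = f e := by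
  obtain ⟨n, rfl⟩ := R.rot_sameCycle d e h
  have key : ∀ n : ℤ, ∀ d, f ((R.rot ^ n) d) = f d := by
    intro n
    induction n with
    | zero => simp
    | succ n ih =>
      intro d
      rw [zpow_add_one, Equiv.Perm.mul_apply, ih, hf]
    | pred n ih =>
      intro d
      rw [zpow_sub_one, Equiv.Perm.mul_apply, ih, ← hf, Equiv.Perm.coe_inv, Equiv.apply_symm_apply]
  exact (key n d).symm

variable [Fintype V] [DecidableEq V] [DecidableRel G.Adj]

instance finite_face (R : RotationSystem G) : Finite R.Face :=
  Quotient.finite _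

theorem exists_dart_of_fst [Nonempty G.Dart] (hconn : G.Connected) (v : V) :
    ∃ d : G.Dart, d.fst = v := by
  obtain ⟨d⟩ := ‹Nonempty G.Dart›
  have : Nontrivial V := ⟨⟨d.fst, d.snd, d.fst_ne_snd⟩⟩
  obtain ⟨w, hw⟩ := hconn.preconnected.exists_adj_of_nontrivial v
  exact ⟨⟨(v, w), hw⟩, rfl⟩

theorem eq_const_of_adj (hconn : G.Connected) {α : Type*} (f : V → α)
    (hf : ∀ d : G.Dart, f d.fst = f d.snd) (u v : V) : f u = f v := by
  obtain ⟨p⟩ := hconn.preconnected u v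
  induction p with
  | nil => rfl
  | cons h _ ih => exact (hf ⟨(_, _), h⟩).trans ih

theorem IsPlane.card_eq [Nonempty G.Dart] {R : RotationSystem G} (hR : R.IsPlane)
    (hconn : G.Connected) [Fintype R.Face] :
    Fintype.card V + Fintype.card R.Face = Fintype.card G.edgeSet + 2 := by
  have h := hR
  rw [IsPlane] at h
  have h1 : {v : V | ∀ w, ¬ G.Adj v w} = ∅ := by
    rw [Set.eq_empty_iff_forall_notMem]
    intro v hv
    obtain ⟨d, rfl⟩ := exists_dart_of_fst hconn v
    exact hv d.snd d.adj
  have h2 : Nat.card G.ConnectedComponent = 1 := by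
    rw [Nat.card_eq_one_iff_unique]
    exact ⟨hconn.preconnected.subsingleton_connectedComponent,
      ⟨G.connectedComponentMk hconn.nonempty.some⟩⟩
  rw [h1, h2] at h
  simpa [Nat.card_eq_fintype_card] using h

section Potential

variable {K : Type*} [Field K] (R : RotationSystem G)

open Classical in
/-- The incidence matrix of vertices and oriented edges. -/
noncomputable def vertexMatrix (K : Type*) [Field K] : Matrix V G.edgeSet K :=
  Matrix.of fun v e => (if (edgeDart e).snd = v then 1 else 0) - if (edgeDart e).fst = v then 1 else 0

open Classical in
/-- The incidence matrix of faces and oriented edges. -/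
noncomputable def faceMatrix (K : Type*) [Field K] : Matrix R.Face G.edgeSet K :=
  Matrix.of fun F e => (if R.faceOf (edgeDart e) = F then 1 else 0)
    - if R.faceOf (edgeDart e).symm = F then 1 else 0

theorem vertexMatrix_transpose_mulVec (p : V → K) (e : G.edgeSet) :
    (vertexMatrix (G := G) K).transpose.mulVec p e = p (edgeDart e).snd - p (edgeDart e).fst := by
  simp [Matrix.mulVec, dotProduct, vertexMatrix, sub_mul]

theorem faceMatrix_transpose_mulVec [Fintype R.Face] (s : R.Face → K) (e : G.edgeSet) :
    (faceMatrix R K).transpose.mulVec s e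
      = s (R.faceOf (edgeDart e)) - s (R.faceOf (edgeDart e).symm) := by
  classical
  simp [Matrix.mulVec, dotProduct, faceMatrix, sub_mul, Finset.sum_sub_distrib]

open Classical in
theorem vertexMatrix_mulVec (g : G.Dart → K) (hg : ∀ d, g d.symm = - g d) (v : V) :
    (vertexMatrix (G := G) K).mulVec (fun e => g (edgeDart e)) v
      = - ∑ d : G.Dart, if d.fst = v then g d else 0 := by
  rw [← sum_edgeDart, ← Finset.sum_neg_distrib]
  simp only [Matrix.mulVec, dotProduct, vertexMatrix, Matrix.of_apply]
  refine Finset.sum_congr rfl fun e _ => ?_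
  have : (edgeDart e).symm.fst = (edgeDart e).snd := rfl
  rw [hg, this]
  split_ifs <;> simp

open Classical in
theorem faceMatrix_mulVec (g : G.Dart → K) (hg : ∀ d, g d.symm = - g d) (F : R.Face) :
    (faceMatrix R K).mulVec (fun e => g (edgeDart e)) F
      = ∑ d : G.Dart, if R.faceOf d = F then g d else 0 := by
  rw [← sum_edgeDart]
  simp only [Matrix.mulVec, dotProduct, faceMatrix, Matrix.of_apply]
  refine Finset.sum_congr rfl fun e _ => ?_
  rw [hg]
  split_ifs <;> simp

/-- The boundary of a boundary vanishes: at a vertex, each corner of `F` is counted once for the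
dart leaving and once for the dart arriving. Reindexing by `R.rot` matches the two counts. -/
theorem vertexMatrix_mul_faceMatrix_transpose [Fintype R.Face] :
    vertexMatrix (G := G) K * (faceMatrix R K).transpose = 0 := by
  classical
  ext v F
  have h := vertexMatrix_mulVec (G := G) (K := K) (fun d : G.Dart =>
    (if R.faceOf d = F then 1 else 0) - if R.faceOf d.symm = F then 1 else 0) (by simp) v
  have h0 : (vertexMatrix (G := G) K * (faceMatrix R K).transpose) v F =
    (vertexMatrix (G := G) K).mulVec (fun e => (if R.faceOf (edgeDart e) = F then 1 else 0)
      - if R.faceOf (edgeDart e).symm = F then 1 else 0) v := by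
    simp only [Matrix.mul_apply, Matrix.mulVec, dotProduct, faceMatrix, Matrix.of_apply,
      Matrix.transpose_apply]
  rw [h0, h, Matrix.zero_apply, neg_eq_zero]
  have h1 : ∑ d : G.Dart, (if d.fst = v then (if R.faceOf d.symm = F then (1 : K) else 0) else 0)
      = ∑ d : G.Dart, (if d.fst = v then (if R.faceOf d = F then (1 : K) else 0) else 0) := by
    rw [← Equiv.sum_comp R.rot]
    simp only [R.rot_fst, faceOf_symm_rot]
  refine Eq.trans ?_ (sub_eq_zero.2 h1.symm)
  rw [← Finset.sum_sub_distrib]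
  refine Finset.sum_congr rfl fun d _ => ?_
  split_ifs <;> simp

theorem vertexMatrix_corank (hconn : G.Connected) (f : V → K)
    (hf : (vertexMatrix (G := G) K).transpose.mulVec f = 0) : ∃ c, f = fun _ => c := by
  refine ⟨f hconn.nonempty.some, funext fun v => eq_const_of_adj hconn f (fun d => ?_) _ _⟩
  obtain ⟨e, he⟩ := eq_edgeDart_or d
  have := congrFun hf e
  rw [vertexMatrix_transpose_mulVec, Pi.zero_apply, sub_eq_zero] at this
  rcases he with rfl | rfl
  · exact this.symm
  · exact this

/-- Connectedness of the dual graph: a function with equal values on the two sides of every edge is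
constant on the faces around a vertex, and then along the edges of the connected graph. -/
theorem faceMatrix_corank [Nonempty G.Dart] (hconn : G.Connected) [Fintype R.Face]
    (f : R.Face → K) (hf : (faceMatrix R K).transpose.mulVec f = 0) : ∃ c, f = fun _ => c := by
  have hs : ∀ d, f (R.faceOf d.symm) = f (R.faceOf d) := by
    intro d
    obtain ⟨e, he⟩ := eq_edgeDart_or d
    have := congrFun hf e
    rw [faceMatrix_transpose_mulVec, Pi.zero_apply, sub_eq_zero] at this
    rcases he with rfl | rfl
    · exact this.symm
    · simpa using this
  have hr : ∀ d e : G.Dart, d.fst = e.fst → f (R.faceOf d) = f (R.faceOf e) := fun d e h =>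
    R.eq_of_fst_eq (fun d => f (R.faceOf d))
      (fun d => by rw [← hs (R.rot d), faceOf_symm_rot]) h
  choose a ha using exists_dart_of_fst (G := G) hconn
  have hc : ∀ d e : G.Dart, f (R.faceOf d) = f (R.faceOf e) := by
    intro d e
    rw [hr d (a d.fst) (ha _).symm, hr e (a e.fst) (ha _).symm]
    refine eq_const_of_adj hconn (fun v => f (R.faceOf (a v))) (fun d => ?_) _ _
    rw [hr (a d.fst) d (ha _), hr (a d.snd) d.symm (ha _), hs]
  obtain ⟨d⟩ := ‹Nonempty G.Dart›
  refine ⟨f (R.faceOf d), funext fun F => ?_⟩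
  induction F using Quotient.ind with
  | _ e => exact hc e d

open Classical in
/-- On a plane connected graph, an antisymmetric function on the darts whose sums along the face
boundaries vanish is the coboundary of a function on the vertices. -/
theorem IsPlane.exists_vertex_potential [Nonempty G.Dart] {R : RotationSystem G}
    (hR : R.IsPlane) (hconn : G.Connected) (g : G.Dart → K) (hg : ∀ d, g d.symm = - g d)
    (hF : ∀ F, ∑ d : G.Dart, (if R.faceOf d = F then g d else 0) = 0) :
    ∃ p : V → K, ∀ d : G.Dart, g d = p d.snd - p d.fst := by
  have := Fintype.ofFinite R.Face
  obtain ⟨p, hp⟩ := Matrix.exists_transpose_mulVec_eq (vertexMatrix (G := G) K) (faceMatrix R K)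
    (by rw [← Matrix.transpose_inj, Matrix.transpose_mul, Matrix.transpose_transpose,
      vertexMatrix_mul_faceMatrix_transpose, Matrix.transpose_zero])
    (vertexMatrix_corank hconn) (faceMatrix_corank R hconn) (hR.card_eq hconn)
    (fun e => g (edgeDart e)) (funext fun F => by rw [faceMatrix_mulVec R g hg, hF]; rfl)
  refine ⟨p, fun d => ?_⟩
  obtain ⟨e, he⟩ := eq_edgeDart_or d
  have := congrFun hp e
  rw [vertexMatrix_transpose_mulVec] at this
  rcases he with rfl | rfl
  · exact this.symm
  · rw [hg, ← this, neg_sub]; rfl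

open Classical in
/-- On a plane connected graph, an antisymmetric function on the darts whose sums around the
vertices vanish is the coboundary of a function on the faces. -/
theorem IsPlane.exists_face_potential [Nonempty G.Dart] {R : RotationSystem G}
    (hR : R.IsPlane) (hconn : G.Connected) (g : G.Dart → K) (hg : ∀ d, g d.symm = - g d)
    (hF : ∀ v, ∑ d : G.Dart, (if d.fst = v then g d else 0) = 0) :
    ∃ s : R.Face → K, ∀ d : G.Dart, g d = s (R.faceOf d) - s (R.faceOf d.symm) := by
  have := Fintype.ofFinite R.Face
  obtain ⟨p, hp⟩ := Matrix.exists_transpose_mulVec_eq (faceMatrix R K) (vertexMatrix (G := G) K)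
    (vertexMatrix_mul_faceMatrix_transpose R) (faceMatrix_corank R hconn)
    (vertexMatrix_corank hconn) (by rw [add_comm, hR.card_eq hconn])
    (fun e => g (edgeDart e)) (funext fun v => by
      rw [vertexMatrix_mulVec g hg, hF, neg_zero]; rfl)
  refine ⟨p, fun d => ?_⟩
  obtain ⟨e, he⟩ := eq_edgeDart_or d
  have := congrFun hp e
  rw [faceMatrix_transpose_mulVec] at this
  rcases he with rfl | rfl
  · exact this.symm
  · rw [hg, ← this, neg_sub, Dart.symm_symm]

end Potential

end RotationSystem

/-! ### Rectilinear data with separately drawn faces -/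

/-- Combinatorial and geometric data of a rectilinear graph whose faces are drawn separately.
Directions are numbered counterclockwise, with `0` pointing to the right; `quad v k` is the face
containing the open quadrant at `v` between the directions `k` and `k + 1`. All faces use the same
abscissae, but each face has its own ordinates. -/
structure OrthoData {V : Type*} (G : SimpleGraph V) (Φ : Type*) where
  dir : G.Dart → ZMod 4
  quad : V → ZMod 4 → Φ
  x : V → ℝ
  y : Φ → V → ℝ

namespace OrthoData

variable {V : Type*} {G : SimpleGraph V} {Φ : Type*}

/-- The face to the left of a dart. -/
def left (S : OrthoData G Φ) (d : G.Dart) : Φ := S.quad d.fst (S.dir d)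

/-- The vertex lies on the boundary of the face. -/
def On (S : OrthoData G Φ) (F : Φ) (v : V) : Prop := ∃ k, S.quad v k = F

/-- The edge of the dart lies on the boundary of the face. -/
def Inc (S : OrthoData G Φ) (F : Φ) (d : G.Dart) : Prop := S.left d = F ∨ S.left d.symm = F

/-- The data come from a graph embedding in which every face is drawn without crossings. -/
structure Valid [Fintype V] [DecidableRel G.Adj] [DecidableEq Φ] (S : OrthoData G Φ) :
    Prop where
  dir_symm : ∀ d, S.dir d.symm = S.dir d + 2
  dir_inj : ∀ d e, d.fst = e.fst → S.dir d = S.dir e → d = e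
  left_symm : ∀ d, S.left d.symm = S.quad d.fst (S.dir d - 1)
  quad_of_no_dart : ∀ v k, (∀ d : G.Dart, d.fst = v → S.dir d ≠ k) → S.quad v k = S.quad v (k - 1)
  -- The boundary walk is closed (for the winding number), and the boundary is connected; both are
  -- stated through test functions so that no walk has to be handled.
  circ : ∀ F (g : V → ℤ), ∑ d : G.Dart, (if S.left d = F then g d.fst - g d.snd else 0) = 0
  face_conn : ∀ F (g : V → ℤ), (∀ d : G.Dart, S.left d = F → g d.fst = g d.snd) →
    ∀ u v, S.On F u → S.On F v → g u = g v
  x_right : ∀ d, S.dir d = 0 → S.x d.fst < S.x d.snd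
  x_up : ∀ d, S.dir d = 1 → S.x d.fst = S.x d.snd
  y_right : ∀ F d, S.dir d = 0 → S.Inc F d → S.y F d.fst = S.y F d.snd
  y_up : ∀ F d, S.dir d = 1 → S.Inc F d → S.y F d.fst < S.y F d.snd
  injOn : ∀ F u v, S.On F u → S.On F v → S.x u = S.x v → S.y F u = S.y F v → u = v
  right_vertex : ∀ F d v, S.dir d = 0 → S.Inc F d → S.On F v → S.y F v = S.y F d.fst →
    S.x d.fst < S.x v → S.x v < S.x d.snd → False
  up_vertex : ∀ F d v, S.dir d = 1 → S.Inc F d → S.On F v → S.x v = S.x d.fst →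
    S.y F d.fst < S.y F v → S.y F v < S.y F d.snd → False
  right_up : ∀ F d e, S.dir d = 0 → S.dir e = 1 → S.Inc F d → S.Inc F e →
    S.x d.fst < S.x e.fst → S.x e.fst < S.x d.snd →
    S.y F e.fst < S.y F d.fst → S.y F d.fst < S.y F e.snd → False

theorem zmod4_cases (k : ZMod 4) : k = 0 ∨ k = 1 ∨ k = 2 ∨ k = 3 := by
  revert k; decide

variable [Fintype V] [DecidableRel G.Adj] [DecidableEq Φ] {S : OrthoData G Φ}

theorem inc_symm {F : Φ} {d : G.Dart} : S.Inc F d.symm ↔ S.Inc F d := by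
  rw [Inc, Inc, SimpleGraph.Dart.symm_symm, or_comm]

namespace Valid

theorem dir_cases (hS : S.Valid) (d : G.Dart) : (S.dir d = 0 ∨ S.dir d = 1) ∨
    (S.dir d.symm = 0 ∨ S.dir d.symm = 1) := by
  rw [hS.dir_symm]
  rcases zmod4_cases (S.dir d) with h | h | h | h <;> rw [h] <;> decide

theorem left_eq_quad_snd (hS : S.Valid) (d : G.Dart) : S.left d = S.quad d.snd (S.dir d + 1) := by
  have h := hS.left_symm d.symm
  rw [SimpleGraph.Dart.symm_symm, hS.dir_symm] at h
  rw [h]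
  change S.quad d.snd _ = _
  congr 1
  generalize S.dir d = k
  revert k; decide

theorem left_symm_eq_quad_snd (hS : S.Valid) (d : G.Dart) :
    S.left d.symm = S.quad d.snd (S.dir d + 2) := by
  rw [left, hS.dir_symm]; rfl

theorem on_fst (hS : S.Valid) {F : Φ} {d : G.Dart} (h : S.Inc F d) : S.On F d.fst := by
  rcases h with h | h
  · exact ⟨_, h⟩
  · exact ⟨_, (hS.left_symm d).symm.trans h⟩

theorem on_snd (hS : S.Valid) {F : Φ} {d : G.Dart} (h : S.Inc F d) : S.On F d.snd :=
  hS.on_fst (d := d.symm) (inc_symm.2 h)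

theorem fst_inj (hS : S.Valid) {d e : G.Dart} (h : d.fst = e.fst) (h' : S.dir d = S.dir e) :
    d = e := hS.dir_inj d e h h'

theorem snd_inj (hS : S.Valid) {d e : G.Dart} (h : d.snd = e.snd) (h' : S.dir d = S.dir e) :
    d = e := by
  have := hS.dir_inj d.symm e.symm h (by rw [hS.dir_symm, hS.dir_symm, h'])
  exact SimpleGraph.Dart.symm_involutive.injective this

end Valid

/-! ### The winding number of a face boundary -/

/-- The indicator of `a < X`. -/
noncomputable def ind (a X : ℝ) : ℤ := if a < X then 1 else 0

theorem ind_sub_ind {a b X : ℝ} (hab : a ≤ b) :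
    ind a X - ind b X = if a < X ∧ X ≤ b then 1 else 0 := by
  unfold ind
  split_ifs <;> grind

theorem ind_sub_ind' {a X X' : ℝ} (h : X ≤ X') :
    ind a X' - ind a X = if X ≤ a ∧ a < X' then 1 else 0 := by
  unfold ind
  split_ifs <;> grind

/-- The winding number of the boundary walk of `F`, as drawn in the face `F`, around the generic
point `(X, Y)`, counted on the ray downwards. -/
noncomputable def wind (S : OrthoData G Φ) (F : Φ) (X Y : ℝ) : ℤ :=
  ∑ d : G.Dart, if S.left d = F then
    ind (S.y F d.fst) Y * (ind (S.x d.fst) X - ind (S.x d.snd) X) else 0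

namespace Valid

/-- Summation by parts along the closed boundary walk, with the indicator of the quadrant below and
to the left of `(X, Y)`: the winding number can as well be counted on the ray to the left. -/
theorem wind_eq (hS : S.Valid) (F : Φ) (X Y : ℝ) : S.wind F X Y = ∑ d : G.Dart,
    if S.left d = F then ind (S.x d.snd) X * (ind (S.y F d.snd) Y - ind (S.y F d.fst) Y) else 0 := by
  rw [← sub_eq_zero, wind, ← Finset.sum_sub_distrib,
    ← hS.circ F (fun v => ind (S.y F v) Y * ind (S.x v) X)]
  refine Finset.sum_congr rfl fun d _ => ?_
  split_ifs <;> ring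

theorem sum_eq_of_dart {f : G.Dart → ℤ} (e : G.Dart)
    (h : ∀ d, f d ≠ 0 → d = e ∨ d = e.symm) : ∑ d, f d = f e + f e.symm := by
  classical
  rw [← Finset.sum_pair (SimpleGraph.Dart.symm_ne e).symm]
  symm
  apply Finset.sum_subset (Finset.subset_univ _)
  intro d _ hd
  by_contra h0
  exact hd (by simpa using h d h0)

theorem wind_sub_vertical (S : OrthoData G Φ) (F : Φ) {X Y Y' : ℝ} (hY : Y ≤ Y') :
    S.wind F X Y' - S.wind F X Y = ∑ d : G.Dart, if S.left d = F then
      (if Y ≤ S.y F d.fst ∧ S.y F d.fst < Y' then 1 else 0) *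
        (ind (S.x d.fst) X - ind (S.x d.snd) X) else 0 := by
  rw [wind, wind, ← Finset.sum_sub_distrib]
  refine Finset.sum_congr rfl fun d _ => ?_
  rw [← ind_sub_ind' hY]
  split_ifs <;> ring

theorem wind_sub_horizontal (hS : S.Valid) (F : Φ) {X X' Y : ℝ} (hX : X ≤ X') :
    S.wind F X' Y - S.wind F X Y = ∑ d : G.Dart, if S.left d = F then
      (if X ≤ S.x d.snd ∧ S.x d.snd < X' then 1 else 0) *
        (ind (S.y F d.snd) Y - ind (S.y F d.fst) Y) else 0 := by
  rw [hS.wind_eq, hS.wind_eq, ← Finset.sum_sub_distrib]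
  refine Finset.sum_congr rfl fun d _ => ?_
  rw [← ind_sub_ind' hX]
  split_ifs <;> ring

/-- The right dart `d` of the face `F` crosses the vertical segment at `X` from `Y` to `Y'`. -/
def _root_.OrthoData.CrossV (S : OrthoData G Φ) (F : Φ) (X Y Y' : ℝ) (d : G.Dart) : Prop :=
  S.dir d = 0 ∧ S.Inc F d ∧ Y ≤ S.y F d.fst ∧ S.y F d.fst < Y' ∧ S.x d.fst < X ∧ X ≤ S.x d.snd

/-- The up dart `d` of the face `F` crosses the horizontal segment at `Y` from `X` to `X'`. -/
def _root_.OrthoData.CrossH (S : OrthoData G Φ) (F : Φ) (X X' Y : ℝ) (d : G.Dart) : Prop :=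
  S.dir d = 1 ∧ S.Inc F d ∧ X ≤ S.x d.fst ∧ S.x d.fst < X' ∧ S.y F d.fst < Y ∧ Y ≤ S.y F d.snd

/-- Vertical edges contribute nothing because their ends have the same abscissa. The half-open
inequalities in `CrossV` come from the strict inequality in `ind`. -/
theorem crossV_of_ne_zero (hS : S.Valid) {F : Φ} {X Y Y' : ℝ} {d : G.Dart}
    (h : (if S.left d = F then (if Y ≤ S.y F d.fst ∧ S.y F d.fst < Y' then 1 else 0) *
        (ind (S.x d.fst) X - ind (S.x d.snd) X) else 0) ≠ 0) :
    S.CrossV F X Y Y' d ∨ S.CrossV F X Y Y' d.symm := by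
  have hl : S.left d = F := by by_contra h'; simp [h'] at h
  have hy : Y ≤ S.y F d.fst ∧ S.y F d.fst < Y' := by by_contra h'; simp [h'] at h
  have hx : ind (S.x d.fst) X - ind (S.x d.snd) X ≠ 0 := by
    intro h'; simp [h'] at h
  have hi : S.Inc F d := Or.inl hl
  rcases hS.dir_cases d with (h0 | h0) | (h0 | h0)
  · left
    rw [ind_sub_ind (hS.x_right d h0).le] at hx
    have : S.x d.fst < X ∧ X ≤ S.x d.snd := by by_contra h'; simp [h'] at hx
    exact ⟨h0, hi, hy.1, hy.2, this⟩
  · simp [hS.x_up d h0] at hx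
  · right
    have h1 := hS.y_right F _ h0 (inc_symm.2 hi)
    have h3 : S.x d.snd ≤ S.x d.fst := (hS.x_right _ h0).le
    rw [← neg_sub, ind_sub_ind h3] at hx
    have : S.x d.snd < X ∧ X ≤ S.x d.fst := by by_contra h'; simp [h'] at hx
    have h2 : S.y F d.symm.fst = S.y F d.fst := h1
    exact ⟨h0, inc_symm.2 hi, h2 ▸ hy.1, h2 ▸ hy.2, this⟩
  · have h1 : S.x d.snd = S.x d.fst := hS.x_up _ h0
    simp [h1] at hx

theorem crossH_of_ne_zero (hS : S.Valid) {F : Φ} {X X' Y : ℝ} {d : G.Dart}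
    (h : (if S.left d = F then (if X ≤ S.x d.snd ∧ S.x d.snd < X' then 1 else 0) *
        (ind (S.y F d.snd) Y - ind (S.y F d.fst) Y) else 0) ≠ 0) :
    S.CrossH F X X' Y d ∨ S.CrossH F X X' Y d.symm := by
  have hl : S.left d = F := by by_contra h'; simp [h'] at h
  have hx : X ≤ S.x d.snd ∧ S.x d.snd < X' := by by_contra h'; simp [h'] at h
  have hy : ind (S.y F d.snd) Y - ind (S.y F d.fst) Y ≠ 0 := by
    intro h'; simp [h'] at h
  have hi : S.Inc F d := Or.inl hl
  rcases hS.dir_cases d with (h0 | h0) | (h0 | h0)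
  · simp [hS.y_right F d h0 hi] at hy
  · left
    rw [← neg_sub, ind_sub_ind (hS.y_up F d h0 hi).le] at hy
    have : S.y F d.fst < Y ∧ Y ≤ S.y F d.snd := by by_contra h'; simp [h'] at hy
    have h1 := hS.x_up d h0
    exact ⟨h0, hi, h1 ▸ hx.1, h1 ▸ hx.2, this⟩
  · have h1 : S.y F d.snd = S.y F d.fst := hS.y_right F _ h0 (inc_symm.2 hi)
    simp [h1] at hy
  · right
    have h3 : S.y F d.snd ≤ S.y F d.fst := (hS.y_up F _ h0 (inc_symm.2 hi)).le
    rw [ind_sub_ind h3] at hy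
    have : S.y F d.snd < Y ∧ Y ≤ S.y F d.fst := by by_contra h'; simp [h'] at hy
    exact ⟨h0, inc_symm.2 hi, hx.1, hx.2, this⟩

theorem wind_eq_of_vertical (hS : S.Valid) {F : Φ} {X Y Y' : ℝ} (hY : Y ≤ Y')
    (h : ∀ d, ¬ S.CrossV F X Y Y' d) : S.wind F X Y' = S.wind F X Y := by
  rw [← sub_eq_zero, wind_sub_vertical S F hY]
  refine Finset.sum_eq_zero fun d _ => ?_
  by_contra h0
  exact (hS.crossV_of_ne_zero h0).elim (h _) (h _)

theorem wind_eq_of_horizontal (hS : S.Valid) {F : Φ} {X X' Y : ℝ} (hX : X ≤ X')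
    (h : ∀ d, ¬ S.CrossH F X X' Y d) : S.wind F X' Y = S.wind F X Y := by
  rw [← sub_eq_zero, hS.wind_sub_horizontal F hX]
  refine Finset.sum_eq_zero fun d _ => ?_
  by_contra h0
  exact (hS.crossH_of_ne_zero h0).elim (h _) (h _)

/-- A single edge crossed upwards contributes `1` if `F` is above it and `-1` if `F` is below it;
for a bridge with `F` on both sides the contributions cancel. -/
theorem wind_sub_of_crossV (hS : S.Valid) {F : Φ} {X Y Y' : ℝ} (hY : Y ≤ Y') {e : G.Dart}
    (he : S.CrossV F X Y Y' e) (h : ∀ d, S.CrossV F X Y Y' d → d = e) :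
    S.wind F X Y' - S.wind F X Y =
      (if S.left e = F then 1 else 0) - if S.left e.symm = F then 1 else 0 := by
  rw [wind_sub_vertical S F hY, sum_eq_of_dart e fun d hd => (hS.crossV_of_ne_zero hd).imp (h d)
    fun h' => by rw [← h _ h', SimpleGraph.Dart.symm_symm]]
  obtain ⟨h0, hi, h1, h2, h3, h4⟩ := he
  have h5 : S.y F e.symm.fst = S.y F e.fst := (hS.y_right F e h0 hi).symm
  have h6 : ind (S.x e.fst) X - ind (S.x e.snd) X = 1 := by
    rw [ind_sub_ind (hS.x_right e h0).le, if_pos ⟨h3, h4⟩]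
  have h7 : ind (S.x e.symm.fst) X - ind (S.x e.symm.snd) X = -1 := by
    rw [← h6, neg_sub]; rfl
  rw [h5, h6, h7, if_pos (show Y ≤ S.y F e.fst ∧ S.y F e.fst < Y' from ⟨h1, h2⟩)]
  split_ifs <;> norm_num

theorem wind_sub_of_crossH (hS : S.Valid) {F : Φ} {X X' Y : ℝ} (hX : X ≤ X') {e : G.Dart}
    (he : S.CrossH F X X' Y e) (h : ∀ d, S.CrossH F X X' Y d → d = e) :
    S.wind F X Y - S.wind F X' Y =
      (if S.left e = F then 1 else 0) - if S.left e.symm = F then 1 else 0 := by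
  rw [← neg_sub, hS.wind_sub_horizontal F hX,
    sum_eq_of_dart e fun d hd => (hS.crossH_of_ne_zero hd).imp (h d)
    fun h' => by rw [← h _ h', SimpleGraph.Dart.symm_symm]]
  obtain ⟨h0, hi, h1, h2, h3, h4⟩ := he
  have h5 : S.x e.snd = S.x e.fst := (hS.x_up e h0).symm
  have h8 : S.x e.symm.snd = S.x e.fst := rfl
  have h6 : ind (S.y F e.snd) Y - ind (S.y F e.fst) Y = -1 := by
    rw [← neg_sub, ind_sub_ind (hS.y_up F e h0 hi).le, if_pos ⟨h3, h4⟩]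
  have h7 : ind (S.y F e.symm.snd) Y - ind (S.y F e.symm.fst) Y = 1 := by
    rw [← neg_neg 1, ← h6, neg_sub]; rfl
  rw [h5, h6, h8, h7, if_pos (show X ≤ S.x e.fst ∧ S.x e.fst < X' from ⟨h1, h2⟩)]
  split_ifs <;> norm_num

end Valid

end OrthoData

theorem Finset.exists_gap (s : Finset ℝ) : ∃ ε > 0, ∀ a ∈ s, ∀ b ∈ s, a < b + 2 * ε → a ≤ b := by
  classical
  have key : ∀ t : Finset (ℝ × ℝ), ∃ ε > 0, ∀ p ∈ t, p.2 < p.1 → 2 * ε ≤ p.1 - p.2 := by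
    intro t
    induction t using Finset.induction with
    | empty => exact ⟨1, one_pos, by simp⟩
    | insert p t _ ih =>
      obtain ⟨ε, hε, h⟩ := ih
      by_cases hp : p.2 < p.1
      · refine ⟨min ε ((p.1 - p.2) / 2), lt_min hε (by linarith), fun q hq hlt => ?_⟩
        rcases Finset.mem_insert.1 hq with rfl | hq
        · linarith [min_le_right ε ((q.1 - q.2) / 2)]
        · linarith [min_le_left ε ((p.1 - p.2) / 2), h q hq hlt]
      · refine ⟨ε, hε, fun q hq hlt => ?_⟩
        rcases Finset.mem_insert.1 hq with rfl | hq
        · exact (hp hlt).elim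
        · exact h q hq hlt
  obtain ⟨ε, hε, h⟩ := key (s ×ˢ s)
  refine ⟨ε, hε, fun a ha b hb hab => ?_⟩
  by_contra! hlt
  have := h (a, b) (by simp [ha, hb]) hlt
  simp only at this
  linarith

namespace OrthoData

variable {V : Type*} {G : SimpleGraph V} {Φ : Type*} [Fintype V] [DecidableRel G.Adj]
  [DecidableEq Φ] {S : OrthoData G Φ}

/-- `ε` is small compared to the gaps between different coordinates in the drawing of `F`. -/
structure Sep (S : OrthoData G Φ) (F : Φ) (X ε : ℝ) : Prop where
  pos : 0 < ε
  xle : ∀ u v, S.x u < S.x v + 2 * ε → S.x u ≤ S.x v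
  yle : ∀ u v, S.y F u < S.y F v + 2 * ε → S.y F u ≤ S.y F v
  xleX : ∀ u, S.x u < X + 2 * ε → S.x u ≤ X
  Xlex : ∀ u, X < S.x u + 2 * ε → X ≤ S.x u

theorem exists_sep (S : OrthoData G Φ) (F : Φ) (X : ℝ) : ∃ ε, S.Sep F X ε := by
  classical
  obtain ⟨ε, hε, h⟩ := Finset.exists_gap
    (insert X (Finset.univ.image S.x ∪ Finset.univ.image (S.y F)))
  exact ⟨ε, hε, fun u v => h _ (by simp) _ (by simp), fun u v => h _ (by simp) _ (by simp),
    fun u => h _ (by simp) _ (by simp), fun u => h _ (by simp) _ (by simp)⟩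

/-- The indicator of the quadrant `k` at `u` being in `F`. -/
def quadInd (S : OrthoData G Φ) (F : Φ) (u : V) (k : ZMod 4) : ℤ := if S.quad u k = F then 1 else 0

namespace Valid

theorem quad_eq_of_fst (S : OrthoData G Φ) {d : G.Dart} {u : V} {k : ZMod 4} (h : d.fst = u)
    (hk : S.dir d = k) : S.quad u k = S.left d := by
  subst h hk; rfl

theorem quad_sub_eq_of_fst (hS : S.Valid) {d : G.Dart} {u : V} {k l : ZMod 4} (h : d.fst = u)
    (hk : S.dir d = k) (hl : l = k - 1) : S.quad u l = S.left d.symm := by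
  subst h hk hl; exact (hS.left_symm d).symm

/-- An edge crossing the short segment just to the right of `u` must have the height of `u` and
cannot begin further left, since it would then pass through `u`. -/
theorem fst_eq_of_crossV (hS : S.Valid) {F : Φ} {X ε : ℝ} (hε : S.Sep F X ε) {u : V}
    (hu : S.On F u) {e : G.Dart}
    (he : S.CrossV F (S.x u + ε) (S.y F u - ε) (S.y F u + ε) e) : e.fst = u := by
  obtain ⟨h0, hi, h1, h2, h3, h4⟩ := he
  have := hε.pos
  have hx1 := hε.xle e.fst u (by linarith)
  have hy1 := hε.yle e.fst u (by linarith)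
  have hy2 := hε.yle u e.fst (by linarith)
  rcases hx1.lt_or_eq with h | h
  · exact (hS.right_vertex F e u h0 hi hu (by linarith) h (by linarith)).elim
  · exact hS.injOn F _ _ (hS.on_fst hi) hu h (by linarith)

theorem snd_eq_of_crossV (hS : S.Valid) {F : Φ} {X ε : ℝ} (hε : S.Sep F X ε) {u : V}
    (hu : S.On F u) {e : G.Dart}
    (he : S.CrossV F (S.x u - ε) (S.y F u - ε) (S.y F u + ε) e) : e.snd = u := by
  obtain ⟨h0, hi, h1, h2, h3, h4⟩ := he
  have := hε.pos
  have hx1 := hε.xle u e.snd (by linarith)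
  have hy1 := hε.yle e.fst u (by linarith)
  have hy2 := hε.yle u e.fst (by linarith)
  rcases hx1.lt_or_eq with h | h
  · exact (hS.right_vertex F e u h0 hi hu (by linarith) (by linarith) h).elim
  · exact hS.injOn F _ _ (hS.on_snd hi) hu h.symm (by linarith [hS.y_right F e h0 hi])

theorem fst_eq_of_crossH (hS : S.Valid) {F : Φ} {X ε : ℝ} (hε : S.Sep F X ε) {u : V}
    (hu : S.On F u) {e : G.Dart}
    (he : S.CrossH F (S.x u - ε) (S.x u + ε) (S.y F u + ε) e) : e.fst = u := by
  obtain ⟨h0, hi, h1, h2, h3, h4⟩ := he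
  have := hε.pos
  have hx1 := hε.xle e.fst u (by linarith)
  have hx2 := hε.xle u e.fst (by linarith)
  have hy1 := hε.yle e.fst u (by linarith)
  rcases hy1.lt_or_eq with h | h
  · exact (hS.up_vertex F e u h0 hi hu (by linarith) h (by linarith)).elim
  · exact hS.injOn F _ _ (hS.on_fst hi) hu (by linarith) h

/-- If an edge of `F` leaves `u` to the right, it is the only one crossed. If the edge there is not
on `F`, neither adjacent quadrant is in `F`; if there is no edge, the two quadrants belong to the
same face. In the last two cases nothing is crossed. -/
theorem quadInd_right (hS : S.Valid) {F : Φ} {X ε : ℝ} (hε : S.Sep F X ε) {u : V}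
    (hu : S.On F u) : S.wind F (S.x u + ε) (S.y F u + ε) - S.wind F (S.x u + ε) (S.y F u - ε)
      = S.quadInd F u 0 - S.quadInd F u 3 := by
  have hp := hε.pos
  have hle : S.y F u - ε ≤ S.y F u + ε := by linarith
  by_cases hd : ∃ d : G.Dart, d.fst = u ∧ S.dir d = 0
  · obtain ⟨d, rfl, h0⟩ := hd
    have hu' := fun e he => hS.fst_eq_of_crossV hε hu (e := e) he
    rw [quadInd, quadInd, quad_eq_of_fst S rfl h0,
      hS.quad_sub_eq_of_fst (l := 3) rfl h0 (by decide)]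
    by_cases hi : S.Inc F d
    · refine hS.wind_sub_of_crossV (by linarith) ⟨h0, hi, by linarith, by linarith, by linarith, ?_⟩
        fun e he => hS.fst_inj (hu' e he) (he.1.trans h0.symm)
      by_contra! h
      linarith [hε.xle d.snd d.fst (by linarith), hS.x_right d h0]
    · rw [hS.wind_eq_of_vertical hle, sub_self]
      · rw [Inc, not_or] at hi
        simp [hi.1, hi.2]
      · intro e he
        exact hi (hS.fst_inj (hu' e he) (he.1.trans h0.symm) ▸ he.2.1)
  · rw [hS.wind_eq_of_vertical hle, sub_self, quadInd, quadInd,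
      hS.quad_of_no_dart u 0 (by simpa using hd), sub_eq_zero.2]
    · rfl
    · intro e he
      exact hd ⟨e, hS.fst_eq_of_crossV hε hu he, he.1⟩

theorem quadInd_left (hS : S.Valid) {F : Φ} {X ε : ℝ} (hε : S.Sep F X ε) {u : V}
    (hu : S.On F u) : S.wind F (S.x u - ε) (S.y F u + ε) - S.wind F (S.x u - ε) (S.y F u - ε)
      = S.quadInd F u 1 - S.quadInd F u 2 := by
  have hp := hε.pos
  have hle : S.y F u - ε ≤ S.y F u + ε := by linarith
  by_cases hd : ∃ d : G.Dart, d.fst = u ∧ S.dir d = 2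
  · obtain ⟨d, rfl, h2⟩ := hd
    have h0 : S.dir d.symm = 0 := by rw [hS.dir_symm, h2]; decide
    have hu' := fun e he => hS.snd_eq_of_crossV hε hu (e := e) he
    rw [quadInd, quadInd, quad_eq_of_fst S rfl h2,
      hS.quad_sub_eq_of_fst (l := 1) rfl h2 (by decide)]
    by_cases hi : S.Inc F d.symm
    · have h3 : S.y F d.snd = S.y F d.fst := hS.y_right F _ h0 hi
      have h4 : S.x d.snd < S.x d.fst := hS.x_right _ h0
      refine (hS.wind_sub_of_crossV (e := d.symm) (by linarith) ⟨h0, hi, ?_, ?_, ?_, ?_⟩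
        fun e he => hS.snd_inj (hu' e he) (he.1.trans h0.symm)).trans
          (by rw [SimpleGraph.Dart.symm_symm])
      · change _ ≤ S.y F d.snd
        linarith
      · change S.y F d.snd < _
        linarith
      · change S.x d.snd < _
        by_contra! h
        linarith [hε.xle d.fst d.snd (by linarith)]
      · change _ ≤ S.x d.fst
        linarith
    · rw [hS.wind_eq_of_vertical hle, sub_self]
      · rw [inc_symm, Inc, not_or] at hi
        simp [hi.1, hi.2]
      · intro e he
        exact hi (hS.snd_inj (e := d.symm) (hu' e he) (he.1.trans h0.symm) ▸ he.2.1)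
  · have h := hS.quad_of_no_dart u 2 (by simpa using hd)
    rw [hS.wind_eq_of_vertical hle, sub_self, quadInd, quadInd, h, sub_eq_zero.2]
    · rfl
    · intro e he
      refine hd ⟨e.symm, hS.snd_eq_of_crossV hε hu he, ?_⟩
      rw [hS.dir_symm, he.1]; decide

theorem quadInd_up (hS : S.Valid) {F : Φ} {X ε : ℝ} (hε : S.Sep F X ε) {u : V}
    (hu : S.On F u) : S.wind F (S.x u - ε) (S.y F u + ε) - S.wind F (S.x u + ε) (S.y F u + ε)
      = S.quadInd F u 1 - S.quadInd F u 0 := by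
  have hp := hε.pos
  have hle : S.x u - ε ≤ S.x u + ε := by linarith
  by_cases hd : ∃ d : G.Dart, d.fst = u ∧ S.dir d = 1
  · obtain ⟨d, rfl, h0⟩ := hd
    have hu' := fun e he => hS.fst_eq_of_crossH hε hu (e := e) he
    rw [quadInd, quadInd, quad_eq_of_fst S rfl h0,
      hS.quad_sub_eq_of_fst (l := 0) rfl h0 (by decide)]
    by_cases hi : S.Inc F d
    · refine hS.wind_sub_of_crossH (by linarith) ⟨h0, hi, by linarith, by linarith, by linarith, ?_⟩
        fun e he => hS.fst_inj (hu' e he) (he.1.trans h0.symm)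
      by_contra! h
      linarith [hε.yle d.snd d.fst (by linarith), hS.y_up F d h0 hi]
    · rw [hS.wind_eq_of_horizontal hle, sub_self]
      · rw [Inc, not_or] at hi
        simp [hi.1, hi.2]
      · intro e he
        exact hi (hS.fst_inj (hu' e he) (he.1.trans h0.symm) ▸ he.2.1)
  · have h := hS.quad_of_no_dart u 1 (by simpa using hd)
    rw [hS.wind_eq_of_horizontal hle, sub_self, quadInd, quadInd, h, sub_eq_zero.2]
    · rfl
    · intro e he
      exact hd ⟨e, hS.fst_eq_of_crossH hε hu he, he.1⟩

/-- Sliding along a horizontal edge. -/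
theorem wind_slide_right (hS : S.Valid) {F : Φ} {X ε : ℝ} (hε : S.Sep F X ε) {d : G.Dart}
    (h0 : S.dir d = 0) (hi : S.Inc F d) {X₁ X₂ Y : ℝ} (h1 : S.x d.fst < X₁) (h12 : X₁ ≤ X₂)
    (h2 : X₂ ≤ S.x d.snd) (hY : S.y F d.fst - ε ≤ Y) (hY' : Y ≤ S.y F d.fst + ε) :
    S.wind F X₂ Y = S.wind F X₁ Y := by
  have hp := hε.pos
  refine hS.wind_eq_of_horizontal h12 fun e ⟨h0', hi', k1, k2, k3, k4⟩ => ?_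
  have y1 := hε.yle e.fst d.fst (by linarith)
  have y2 := hε.yle d.fst e.snd (by linarith)
  have hx := hS.x_up e h0'
  rcases y1.lt_or_eq with y1 | y1
  · rcases y2.lt_or_eq with y2 | y2
    · exact hS.right_up F d e h0 h0' hi hi' (by linarith) (by linarith) y1 y2
    · exact hS.right_vertex F d e.snd h0 hi (hS.on_snd hi') y2.symm (by linarith) (by linarith)
  · exact hS.right_vertex F d e.fst h0 hi (hS.on_fst hi') y1 (by linarith) (by linarith)

/-- Sliding along a vertical edge. -/
theorem wind_slide_up (hS : S.Valid) {F : Φ} {X ε : ℝ} (hε : S.Sep F X ε) {d : G.Dart}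
    (h0 : S.dir d = 1) (hi : S.Inc F d) :
    S.wind F (S.x d.fst - ε) (S.y F d.snd - ε) = S.wind F (S.x d.fst - ε) (S.y F d.fst + ε) := by
  have hp := hε.pos
  have hy := hS.y_up F d h0 hi
  have hle : S.y F d.fst + ε ≤ S.y F d.snd - ε := by
    by_contra! h
    linarith [hε.yle d.snd d.fst (by linarith)]
  refine hS.wind_eq_of_vertical hle fun e ⟨h0', hi', k1, k2, k3, k4⟩ => ?_
  have x2 := hε.xle d.fst e.snd (by linarith)
  rcases x2.lt_or_eq with x2 | x2
  · exact hS.right_up F e d h0' h0 hi' hi (by linarith) x2 (by linarith) (by linarith)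
  · have := hS.y_right F e h0' hi'
    exact hS.up_vertex F d e.snd h0 hi (hS.on_snd hi') x2.symm (by linarith) (by linarith)

/-- The winding number does not change while sliding along the left side of an edge, and turning
around its ends changes it exactly as the indicator of the quadrant. So the difference is constant
along the boundary of `F`. -/
theorem wind_conn (hS : S.Valid) {F : Φ} {X ε : ℝ} (hε : S.Sep F X ε) {d : G.Dart}
    (hi : S.Inc F d) :
    S.wind F (S.x d.fst + ε) (S.y F d.fst + ε) - S.quadInd F d.fst 0
      = S.wind F (S.x d.snd + ε) (S.y F d.snd + ε) - S.quadInd F d.snd 0 := by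
  have hp := hε.pos
  wlog h : S.dir d = 0 ∨ S.dir d = 1 generalizing d
  · exact (this (d := d.symm) (inc_symm.2 hi) ((hS.dir_cases d).resolve_left h)).symm
  have hq := hS.left_eq_quad_snd d
  rcases h with h0 | h0
  · have hx := hS.x_right d h0
    have hle : S.x d.fst + ε ≤ S.x d.snd - ε := by
      by_contra! h
      linarith [hε.xle d.snd d.fst (by linarith)]
    have hy := hS.y_right F d h0 hi
    have h1 := hS.wind_slide_right hε h0 hi (Y := S.y F d.snd + ε)
      (by linarith : S.x d.fst < S.x d.fst + ε)
      hle (by linarith) (by linarith) (by linarith)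
    have h2 := hS.quadInd_up hε (hS.on_snd hi)
    have h3 : S.quadInd F d.fst 0 = S.quadInd F d.snd 1 := by
      rw [left, h0] at hq
      rw [quadInd, quadInd, hq]; rfl
    rw [hy]
    omega
  · have h1 := hS.wind_slide_up hε h0 hi
    have h2 := hS.quadInd_up hε (hS.on_snd hi)
    have h3 := hS.quadInd_left hε (hS.on_snd hi)
    have h4 := hS.quadInd_up hε (hS.on_fst hi)
    have h5 : S.quadInd F d.fst 1 = S.quadInd F d.snd 2 := by
      rw [left, h0] at hq
      rw [quadInd, quadInd, hq]; rfl
    rw [← hS.x_up d h0] at h2 h3 ⊢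
    omega

/-- Near the boundary of a face, the winding number tells the face from its complement. -/
theorem exists_wind_eq (hS : S.Valid) {F : Φ} {X ε : ℝ} (hε : S.Sep F X ε) :
    ∃ κ : ℤ, ∀ u, S.On F u →
      S.wind F (S.x u + ε) (S.y F u + ε) = κ + S.quadInd F u 0 ∧
      S.wind F (S.x u - ε) (S.y F u + ε) = κ + S.quadInd F u 1 ∧
      S.wind F (S.x u - ε) (S.y F u - ε) = κ + S.quadInd F u 2 ∧
      S.wind F (S.x u + ε) (S.y F u - ε) = κ + S.quadInd F u 3 := by
  by_cases hF : ∃ u, S.On F u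
  · obtain ⟨u₀, hu₀⟩ := hF
    -- The constant is never evaluated, so bounded and unbounded faces need not be told apart.
    refine ⟨S.wind F (S.x u₀ + ε) (S.y F u₀ + ε) - S.quadInd F u₀ 0, fun u hu => ?_⟩
    have h1 := hS.face_conn F
      (fun v => S.wind F (S.x v + ε) (S.y F v + ε) - S.quadInd F v 0)
      (fun d hd => hS.wind_conn hε (Or.inl hd)) u u₀ hu hu₀
    have h2 := hS.quadInd_up hε hu
    have h3 := hS.quadInd_left hε hu
    have h4 := hS.quadInd_right hε hu
    omega
  · exact ⟨0, fun u hu => (hF ⟨u, hu⟩).elim⟩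

end Valid

end OrthoData

/-! ### The places of a vertical line and their covering relation -/

namespace OrthoData

variable {V : Type*} {G : SimpleGraph V} {Φ : Type*}

/-- The places of the vertical line at `X`: the vertices on the line, and the horizontal edges
crossing it, represented by their left ends. -/
def Place (S : OrthoData G Φ) (X : ℝ) (v : V) : Prop :=
  S.x v = X ∨ S.x v < X ∧ ∃ d : G.Dart, d.fst = v ∧ S.dir d = 0 ∧ X < S.x d.snd

/-- The places of the vertical line at `X` that belong to the boundary of the face `F`. -/
def Rel (S : OrthoData G Φ) (F : Φ) (X : ℝ) (v : V) : Prop :=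
  S.x v = X ∧ S.On F v ∨
    S.x v < X ∧ ∃ d : G.Dart, d.fst = v ∧ S.dir d = 0 ∧ X < S.x d.snd ∧ S.Inc F d

/-- The face `F` lies directly above the place `v`. -/
def Upper (S : OrthoData G Φ) (F : Φ) (X : ℝ) (v : V) : Prop :=
  S.quad v 0 = F ∧ (S.x v = X → S.quad v 1 = F ∧ ¬ ∃ d : G.Dart, d.fst = v ∧ S.dir d = 1)

/-- The face `F` lies directly below the place `v`. -/
def Lower (S : OrthoData G Φ) (F : Φ) (X : ℝ) (v : V) : Prop :=
  S.quad v 3 = F ∧ (S.x v = X → S.quad v 2 = F ∧ ¬ ∃ d : G.Dart, d.snd = v ∧ S.dir d = 1)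

/-- The place `v` is the next one above the place `u`, either along a vertical edge or across the
interior of a face. -/
def Cover (S : OrthoData G Φ) (X : ℝ) (u v : V) : Prop :=
  (∃ d : G.Dart, d.fst = u ∧ d.snd = v ∧ S.dir d = 1 ∧ S.x u = X) ∨
  ∃ F, S.Rel F X u ∧ S.Rel F X v ∧ S.Upper F X u ∧ S.Lower F X v ∧ S.y F u < S.y F v ∧
    ∀ w, S.Rel F X w → S.y F u < S.y F w → S.y F w < S.y F v → False

/-- There is only the unbounded part of the face `F` below the place `v`. -/
def Bottom (S : OrthoData G Φ) (F : Φ) (X : ℝ) (v : V) : Prop :=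
  S.Place X v ∧ S.Lower F X v ∧ ∀ w, S.Rel F X w → S.y F v ≤ S.y F w

theorem Rel.place {S : OrthoData G Φ} {F : Φ} {X : ℝ} {v : V} (h : S.Rel F X v) :
    S.Place X v := by
  rcases h with h | ⟨h, d, h1, h2, h3, -⟩
  · exact Or.inl h.1
  · exact Or.inr ⟨h, d, h1, h2, h3⟩

variable [Fintype V] [DecidableRel G.Adj] [DecidableEq Φ] {S : OrthoData G Φ}

namespace Valid

variable {F : Φ} {X : ℝ} {u v : V}

theorem rel_on (hS : S.Valid) (h : S.Rel F X v) : S.On F v := by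
  rcases h with h | ⟨h, d, rfl, h2, h3, hi⟩
  · exact h.2
  · exact hS.on_fst hi

theorem rel_of_lower (hS : S.Valid) (hv : S.Place X v) (h : S.Lower F X v) : S.Rel F X v := by
  rcases hv with hv | ⟨hv, d, rfl, h2, h3⟩
  · exact Or.inl ⟨hv, _, h.1⟩
  · refine Or.inr ⟨hv, d, rfl, h2, h3, Or.inr ?_⟩
    rw [← h.1, hS.quad_sub_eq_of_fst rfl h2 (by decide)]

/-- If the left ends had different abscissae, the right one would lie in the interior of the edge
that begins at the left one. -/
theorem rel_inj (hS : S.Valid) (hu : S.Rel F X u) (hv : S.Rel F X v)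
    (h : S.y F u = S.y F v) : u = v := by
  wlog hx : S.x v ≤ S.x u generalizing u v
  · exact (this hv hu h.symm (by linarith)).symm
  rcases hx.lt_or_eq with hlt | heq
  · have hu' := hS.rel_on hu
    have hux : S.x u ≤ X := by rcases hu with hu | hu <;> linarith [hu.1]
    rcases hv with hv | ⟨hv, d, rfl, h2, h3, hi⟩
    · linarith [hv.1]
    · exact (hS.right_vertex F d u h2 hi hu' h hlt (by linarith)).elim
  · exact hS.injOn F u v (hS.rel_on hu) (hS.rel_on hv) heq.symm h

/-- For an edge crossing the line, the values known near its left end are carried to the line by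
sliding along the edge. -/
theorem wind_right_of_rel (hS : S.Valid) {ε : ℝ} (hε : S.Sep F X ε) {κ : ℤ}
    (hκ : ∀ u, S.On F u →
      S.wind F (S.x u + ε) (S.y F u + ε) = κ + S.quadInd F u 0 ∧
      S.wind F (S.x u - ε) (S.y F u + ε) = κ + S.quadInd F u 1 ∧
      S.wind F (S.x u - ε) (S.y F u - ε) = κ + S.quadInd F u 2 ∧
      S.wind F (S.x u + ε) (S.y F u - ε) = κ + S.quadInd F u 3) (hv : S.Rel F X v) :
    S.wind F (X + ε) (S.y F v + ε) = κ + S.quadInd F v 0 ∧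
      S.wind F (X + ε) (S.y F v - ε) = κ + S.quadInd F v 3 := by
  have hp := hε.pos
  obtain ⟨h0, -, -, h3⟩ := hκ v (hS.rel_on hv)
  rcases hv with ⟨rfl, hv⟩ | ⟨hv, d, rfl, h2, hX, hi⟩
  · exact ⟨h0, h3⟩
  · have hX' : X + ε ≤ S.x d.snd := by
      by_contra! h
      linarith [hε.xleX d.snd (by linarith)]
    rw [← h0, ← h3]
    exact ⟨hS.wind_slide_right hε h2 hi (by linarith) (by linarith) hX' (by linarith) le_rfl,
      hS.wind_slide_right hε h2 hi (by linarith) (by linarith) hX' le_rfl (by linarith)⟩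

theorem wind_left_of_rel (hS : S.Valid) {ε : ℝ} (hε : S.Sep F X ε) {κ : ℤ}
    (hκ : ∀ u, S.On F u →
      S.wind F (S.x u + ε) (S.y F u + ε) = κ + S.quadInd F u 0 ∧
      S.wind F (S.x u - ε) (S.y F u + ε) = κ + S.quadInd F u 1 ∧
      S.wind F (S.x u - ε) (S.y F u - ε) = κ + S.quadInd F u 2 ∧
      S.wind F (S.x u + ε) (S.y F u - ε) = κ + S.quadInd F u 3) (hv : S.Rel F X v)
    (hl : S.Lower F X v) : S.wind F (X - ε) (S.y F v - ε) = κ + 1 := by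
  have hp := hε.pos
  obtain ⟨-, -, h2, h3⟩ := hκ v (hS.rel_on hv)
  rcases hv with ⟨rfl, hv⟩ | ⟨hv, d, rfl, hd, hX, hi⟩
  · rw [h2, quadInd, if_pos (hl.2 rfl).1]
  · have hX' : S.x d.fst + ε ≤ X - ε := by
      by_contra! h
      linarith [hε.Xlex d.fst (by linarith)]
    rw [quadInd, if_pos hl.1] at h3
    rw [← h3]
    exact hS.wind_slide_right hε hd hi (by linarith) hX' (by linarith) le_rfl (by linarith)

/-- The topmost place below a place with the face `F` below it has the face `F` above it. -/
theorem upper_of_lower (hS : S.Valid) (hu : S.Rel F X u) (hv : S.Rel F X v)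
    (hl : S.Lower F X v) (huv : S.y F u < S.y F v)
    (hb : ∀ w, S.Rel F X w → S.y F u < S.y F w → S.y F w < S.y F v → False) :
    S.Upper F X u := by
  obtain ⟨ε, hε⟩ := S.exists_sep F X
  have hp := hε.pos
  obtain ⟨κ, hκ⟩ := hS.exists_wind_eq hε
  have hy : S.y F u + ε ≤ S.y F v - ε := by
    by_contra! h
    linarith [hε.yle v u (by linarith)]
  -- No edge of `F` crosses the line at `X + ε`, nor the one at `X - ε`, between the two places. So
  -- just above `u` the winding number is still `κ + 1`, its value just below `v`, which means being
  -- inside `F`.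
  have hR : S.wind F (X + ε) (S.y F v - ε) = S.wind F (X + ε) (S.y F u + ε) := by
    refine hS.wind_eq_of_vertical hy fun e ⟨h0, hi, h1, h2, h3, h4⟩ => ?_
    have h5 := hε.xleX e.fst (by linarith)
    refine hb e.fst ?_ (by linarith) (by linarith)
    rcases h5.lt_or_eq with h5 | h5
    · exact Or.inr ⟨h5, e, rfl, h0, by linarith, hi⟩
    · exact Or.inl ⟨h5, hS.on_fst hi⟩
  have hL : S.wind F (X - ε) (S.y F v - ε) = S.wind F (X - ε) (S.y F u + ε) := by
    refine hS.wind_eq_of_vertical hy fun e ⟨h0, hi, h1, h2, h3, h4⟩ => ?_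
    have h5 := hε.Xlex e.snd (by linarith)
    rcases h5.lt_or_eq with h5 | h5
    · exact hb e.fst (Or.inr ⟨by linarith, e, rfl, h0, h5, hi⟩) (by linarith) (by linarith)
    · have h6 := hS.y_right F e h0 hi
      exact hb e.snd (Or.inl ⟨h5.symm, hS.on_snd hi⟩) (by linarith) (by linarith)
  have hu0 : S.quad u 0 = F := by
    have h1 := (hS.wind_right_of_rel hε hκ hu).1
    have h2 := (hS.wind_right_of_rel hε hκ hv).2
    rw [quadInd, if_pos hl.1] at h2
    rw [quadInd] at h1
    by_contra h
    rw [if_neg h] at h1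
    omega
  refine ⟨hu0, fun hx => ?_⟩
  have hu1 : S.quad u 1 = F := by
    have h1 := (hκ u (hS.rel_on hu)).2.1
    have h2 := hS.wind_left_of_rel hε hκ hv hl
    rw [quadInd, hx] at h1
    by_contra h
    rw [if_neg h] at h1
    omega
  refine ⟨hu1, ?_⟩
  -- A vertical edge going up from `u` would end at a place of `F` between `u` and `v`, or end at
  -- `v` from below, or run past `v`.
  rintro ⟨d, rfl, hd⟩
  have hi : S.Inc F d := Or.inl (by rw [left, hd, hu1])
  have hw : S.Rel F X d.snd := Or.inl ⟨by rw [← hx, hS.x_up d hd], hS.on_snd hi⟩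
  have hlt := hS.y_up F d hd hi
  rcases lt_trichotomy (S.y F d.snd) (S.y F v) with h | h | h
  · exact hb _ hw hlt h
  · have hwv := hS.rel_inj hw hv h
    exact (hl.2 (by rw [← hwv, ← hx, hS.x_up d hd])).2 ⟨d, hwv, hd⟩
  · rcases hv with ⟨hvx, hv⟩ | ⟨hvx, e, rfl, he, hX, hi'⟩
    · exact hS.up_vertex F d v hd hi hv (by linarith) huv h
    · exact hS.right_up F e d he hd hi' hi (by linarith) (by linarith) huv h

/-- Without a vertical edge arriving from below, a single face is directly below `v`. The highest
place of that face below `v` is the predecessor; if there is none, `v` is a bottom place. -/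
theorem exists_cover_or_bottom (hS : S.Valid) (hv : S.Place X v) :
    (∃ u, S.Cover X u v) ∨ S.Bottom (S.quad v 3) X v := by
  classical
  by_cases hd : S.x v = X ∧ ∃ d : G.Dart, d.snd = v ∧ S.dir d = 1
  · obtain ⟨hx, d, rfl, hd⟩ := hd
    exact Or.inl ⟨d.fst, Or.inl ⟨d, rfl, rfl, hd, (hS.x_up d hd).trans hx⟩⟩
  have hl : S.Lower (S.quad v 3) X v := by
    refine ⟨rfl, fun hx => ?_⟩
    have hno : ¬ ∃ d : G.Dart, d.snd = v ∧ S.dir d = 1 := fun h => hd ⟨hx, h⟩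
    refine ⟨(hS.quad_of_no_dart v 3 fun d h1 h3 => hno ⟨d.symm, h1, ?_⟩).symm, hno⟩
    rw [hS.dir_symm, h3]; decide
  have hr := hS.rel_of_lower hv hl
  by_cases hb : ∀ w, S.Rel (S.quad v 3) X w → S.y (S.quad v 3) v ≤ S.y (S.quad v 3) w
  · exact Or.inr ⟨hv, hl, hb⟩
  push Not at hb
  obtain ⟨w, hw, hwv⟩ := hb
  obtain ⟨u, hu, hmax⟩ := Finset.exists_max_image
    (Finset.univ.filter fun w => S.Rel (S.quad v 3) X w ∧ S.y (S.quad v 3) w < S.y (S.quad v 3) v)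
    (S.y (S.quad v 3)) ⟨w, by simp [hw, hwv]⟩
  simp only [Finset.mem_filter, Finset.mem_univ, true_and] at hu hmax
  have hb' : ∀ w, S.Rel (S.quad v 3) X w → S.y (S.quad v 3) u < S.y (S.quad v 3) w →
      S.y (S.quad v 3) w < S.y (S.quad v 3) v → False :=
    fun w hw h1 h2 => absurd (hmax w ⟨hw, h2⟩) (not_le.2 h1)
  exact Or.inl ⟨u, Or.inr ⟨_, hu.1, hr, hS.upper_of_lower hu.1 hr hl hu.2 hb', hl, hu.2, hb'⟩⟩

theorem cover_place (hS : S.Valid) (h : S.Cover X u v) : S.Place X u ∧ S.Place X v := by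
  rcases h with ⟨d, rfl, rfl, hd, hx⟩ | ⟨F, hu, hv, -⟩
  · exact ⟨Or.inl hx, Or.inl ((hS.x_up d hd).symm.trans hx)⟩
  · exact ⟨hu.place, hv.place⟩

/-- What lies directly below `v` is either a vertical edge or one face, and in a face the next lower
place is determined by its height. -/
theorem cover_left_unique (hS : S.Valid) {u' : V} (h : S.Cover X u v) (h' : S.Cover X u' v) :
    u = u' := by
  rcases h with ⟨d, rfl, rfl, hd, hx⟩ | ⟨F, hu, hv, -, hl, huv, hb⟩ <;>
  rcases h' with ⟨d', rfl, hdd, hd', hx'⟩ | ⟨F', hu', hv', -, hl', huv', hb'⟩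
  · rw [hS.snd_inj hdd (hd'.trans hd.symm)]
  · exact ((hl'.2 (by rw [← hS.x_up d hd, hx])).2 ⟨d, rfl, hd⟩).elim
  · exact ((hl.2 (by rw [← hdd, ← hS.x_up d' hd', hx'])).2 ⟨d', hdd, hd'⟩).elim
  · obtain rfl : F = F' := hl.1.symm.trans hl'.1
    rcases lt_trichotomy (S.y F u) (S.y F u') with h | h | h
    · exact (hb _ hu' h huv').elim
    · exact hS.rel_inj hu hu' h
    · exact (hb' _ hu h huv).elim

theorem cover_right_unique (hS : S.Valid) {v' : V} (h : S.Cover X u v) (h' : S.Cover X u v') :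
    v = v' := by
  rcases h with ⟨d, rfl, rfl, hd, hx⟩ | ⟨F, hu, hv, hl, -, huv, hb⟩ <;>
  rcases h' with ⟨d', hdd, rfl, hd', hx'⟩ | ⟨F', hu', hv', hl', -, huv', hb'⟩
  · rw [hS.fst_inj hdd (hd'.trans hd.symm)]
  · exact ((hl'.2 hx).2 ⟨d, rfl, hd⟩).elim
  · exact ((hl.2 hx').2 ⟨d', hdd, hd'⟩).elim
  · obtain rfl : F = F' := hl.1.symm.trans hl'.1
    rcases lt_trichotomy (S.y F v) (S.y F v') with h | h | h
    · exact (hb' _ hv huv h).elim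
    · exact hS.rel_inj hv hv' h
    · exact (hb _ hv' huv' h).elim

theorem not_cover_of_bottom (hS : S.Valid) (hv : S.Bottom F X v) : ¬ S.Cover X u v := by
  rintro (⟨d, rfl, rfl, hd, hx⟩ | ⟨F', hu, -, -, hl, huv, -⟩)
  · exact (hv.2.1.2 ((hS.x_up d hd).symm.trans hx)).2 ⟨d, rfl, hd⟩
  · obtain rfl : F = F' := hv.2.1.1.symm.trans hl.1
    exact absurd (hv.2.2 u hu) (not_le.2 huv)

theorem bottom_unique (hS : S.Valid) (hu : S.Bottom F X u) (hv : S.Bottom F X v) : u = v := by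
  have hu' := hS.rel_of_lower hu.1 hu.2.1
  have hv' := hS.rel_of_lower hv.1 hv.2.1
  exact hS.rel_inj hu' hv' (le_antisymm (hu.2.2 v hv') (hv.2.2 u hu'))

end Valid

end OrthoData

/-! ### Moving the vertical line -/

namespace OrthoData

open Relation

variable {V : Type*} {G : SimpleGraph V} {Φ : Type*}

/-- The place `v` is reached from the unbounded part of `F` at the bottom of the line at `X`. -/
def Grounded (S : OrthoData G Φ) (F : Φ) (X : ℝ) (v : V) : Prop :=
  ∃ b, S.Bottom F X b ∧ ReflTransGen (S.Cover X) b v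

/-- Passing from the line at `X` to a nearby line at `X'`: `C u u'` means that the place `u`
continues as the place `u'`, while `lo` and `up` are the faces below and above a place on the side
of `X'`. -/
structure Transition (S : OrthoData G Φ) (X X' : ℝ) (lo up : V → Φ) (C : V → V → Prop) : Prop where
  cover : ∀ u v, S.Cover X u v → up u = lo v ∧ S.Rel (lo v) X u ∧ S.y (lo v) u < S.y (lo v) v ∧
    ∀ w, S.Rel (lo v) X w → S.y (lo v) u < S.y (lo v) w → S.y (lo v) w < S.y (lo v) v → False
  bottom : ∀ F v, S.Bottom F X v → lo v = F
  no_cont : ∀ u, S.Place X u → (∀ u', ¬ C u u') → lo u = up u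
  cont : ∀ u u', C u u' → S.Place X u ∧ S.Place X' u' ∧ S.x u' < X' ∧ S.quad u' 0 = up u ∧
    S.quad u' 3 = lo u ∧ S.y (up u) u' = S.y (up u) u ∧ S.y (lo u) u' = S.y (lo u) u
  rel : ∀ F w', S.Rel F X' w' → ∃ w, C w w' ∧ S.Rel F X w ∧ S.y F w = S.y F w'
  surj : ∀ w', S.Place X' w' → ∃ w, C w w'
  left_unique : ∀ u v w, C u w → C v w → u = v

variable [Fintype V] [DecidableRel G.Adj] [DecidableEq Φ] {S : OrthoData G Φ} {X X' : ℝ}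
  {lo up : V → Φ} {C : V → V → Prop}

theorem Valid.rel_of_quad (hS : S.Valid) {F : Φ} {v : V} (hv : S.Place X v) (hx : S.x v < X)
    (h : S.quad v 0 = F ∨ S.quad v 3 = F) : S.Rel F X v := by
  rcases hv with hv | ⟨hv, d, rfl, h2, h3⟩
  · exact (hx.ne hv).elim
  · refine Or.inr ⟨hv, d, rfl, h2, h3, h.imp (fun h => ?_) fun h => ?_⟩
    · rw [← h, ← h2]; rfl
    · rw [← h, hS.quad_sub_eq_of_fst rfl h2 (by decide)]

/-- By uniqueness of predecessors, every chain ending in `w` passes through `v`. -/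
theorem Valid.cover_cases (hS : S.Valid) {u v w : V} (h : TransGen (S.Cover X) u w)
    (h' : S.Cover X v w) : ReflTransGen (S.Cover X) u v := by
  obtain ⟨c, hc, hcw⟩ := TransGen.tail'_iff.1 h
  rwa [hS.cover_left_unique h' hcw]

namespace Transition

/-- Descend from `v` on the line at `X`. A place without continuation has the same face above and
below it on the side of `X'`, so `F` stays the face in question until a place continues or the
bottom is reached. The induction is on the number of vertices below `v` in the drawing of `F`. -/
theorem exists_lower_cont (T : S.Transition X X' lo up C) (hS : S.Valid) (n : ℕ) {F : Φ} {v : V}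
    (hv : S.Place X v) (hF : lo v = F)
    (hn : (Finset.univ.filter fun w => S.y F w < S.y F v).card = n) :
    (∃ u u', C u u' ∧ TransGen (S.Cover X) u v ∧ up u = F ∧ S.y F u < S.y F v ∧
      ∀ w, S.Rel F X' w → S.y F u < S.y F w → S.y F w < S.y F v → False) ∨
    (∃ b, ReflTransGen (S.Cover X) b v ∧ S.Bottom F X b ∧
      ∀ w, S.Rel F X' w → S.y F v ≤ S.y F w) := by
  induction n using Nat.strong_induction_on generalizing v with
  | _ n ih =>
  rcases hS.exists_cover_or_bottom hv with ⟨u, huv⟩ | hb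
  · obtain ⟨h1, h2, h3, h4⟩ := T.cover u v huv
    rw [hF] at h1 h2 h3 h4
    have h4' : ∀ w, S.Rel F X' w → S.y F u < S.y F w → S.y F w < S.y F v → False := by
      intro w hw
      obtain ⟨g, -, hg, hgy⟩ := T.rel F w hw
      rw [← hgy]
      exact h4 g hg
    by_cases hC : ∃ u', C u u'
    · obtain ⟨u', hu'⟩ := hC
      exact Or.inl ⟨u, u', hu', .single huv, h1, h3, h4'⟩
    -- The place `u` vanishes on the new line and is passed over within `F`.
    have h5 : lo u = F := by rw [T.no_cont u h2.place (not_exists.1 hC), h1]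
    have h6 : ∀ w, S.Rel F X' w → S.y F w ≠ S.y F u := by
      intro w hw h
      obtain ⟨g, hgC, hg, hgy⟩ := T.rel F w hw
      obtain rfl := hS.rel_inj hg h2 (hgy.trans h)
      exact hC ⟨w, hgC⟩
    have hlt : (Finset.univ.filter fun w => S.y F w < S.y F u).card < n := by
      rw [← hn]
      refine Finset.card_lt_card (Finset.ssubset_iff_of_subset ?_ |>.2 ⟨u, ?_, ?_⟩)
      · intro w hw
        simp only [Finset.mem_filter, Finset.mem_univ, true_and] at hw ⊢
        exact hw.trans h3
      · simpa using h3
      · simp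
    rcases ih _ hlt h2.place h5 rfl with ⟨t, t', ht, htu, ht1, ht2, ht3⟩ | ⟨b, hbu, hb, hb'⟩
    · refine Or.inl ⟨t, t', ht, htu.tail huv, ht1, ht2.trans h3, fun w hw hw1 hw2 => ?_⟩
      rcases lt_trichotomy (S.y F w) (S.y F u) with h | h | h
      · exact ht3 w hw hw1 h
      · exact h6 w hw h
      · exact h4' w hw h hw2
    · refine Or.inr ⟨b, hbu.tail huv, hb, fun w hw => ?_⟩
      by_contra! hlt
      exact h4' w hw (lt_of_le_of_ne (hb' w hw) (h6 w hw).symm) hlt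
  · have := T.bottom _ _ hb
    rw [hF] at this
    rw [← this] at hb
    refine Or.inr ⟨v, .refl, hb, fun w hw => ?_⟩
    obtain ⟨g, -, hg, hgy⟩ := T.rel F w hw
    rw [← hgy]
    exact hb.2.2 g hg

/-- The predecessor of `v'` on the new line continues a place below `v`, possibly several covering
steps down; if `v'` has none, the descent from `v` ends at a bottom place of the same face. -/
theorem exists_cover_or_bottom (T : S.Transition X X' lo up C) (hS : S.Valid) {v v' : V}
    (hC : C v v') : (∃ u u', C u u' ∧ TransGen (S.Cover X) u v ∧ S.Cover X' u' v') ∨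
    ∃ F b, ReflTransGen (S.Cover X) b v ∧ S.Bottom F X b ∧ S.Bottom F X' v' := by
  obtain ⟨h1, h2, h3, -, h5, -, h7⟩ := T.cont v v' hC
  have hl : S.Lower (lo v) X' v' := ⟨h5, fun h => (h3.ne h).elim⟩
  rcases T.exists_lower_cont hS _ h1 rfl rfl with ⟨u, u', ht, htu, ht1, ht2, ht3⟩ | ⟨b, hb1, hb, hb'⟩
  · obtain ⟨k1, k2, k3, k4, -, k6, -⟩ := T.cont u u' ht
    rw [ht1] at k4 k6
    refine Or.inl ⟨u, u', ht, htu, Or.inr ⟨lo v, hS.rel_of_quad k2 k3 (Or.inl k4),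
      hS.rel_of_quad h2 h3 (Or.inr h5), ⟨k4, fun h => (k3.ne h).elim⟩, hl, ?_, ?_⟩⟩
    · rwa [k6, h7]
    · rwa [k6, h7]
  · refine Or.inr ⟨_, b, hb1, hb, h2, hl, ?_⟩
    rwa [h7]

theorem transGen_of_cover (T : S.Transition X X' lo up C) (hS : S.Valid) {u u' v v' : V}
    (h : S.Cover X' u' v') (hu : C u u') (hv : C v v') : TransGen (S.Cover X) u v := by
  rcases T.exists_cover_or_bottom hS hv with ⟨t, t', ht, htv, hc⟩ | ⟨F, b, -, -, hb⟩
  · obtain rfl := hS.cover_left_unique h hc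
    rwa [T.left_unique _ _ _ hu ht]
  · exact (hS.not_cover_of_bottom hb h).elim

theorem transGen_of_transGen (T : S.Transition X X' lo up C) (hS : S.Valid) {u u' v v' : V}
    (h : TransGen (S.Cover X') u' v') (hu : C u u') (hv : C v v') :
    TransGen (S.Cover X) u v := by
  induction h generalizing v with
  | single h => exact T.transGen_of_cover hS h hu hv
  | tail h h' ih =>
    obtain ⟨w, hw⟩ := T.surj _ (hS.cover_place h').1
    exact (ih hw).trans (T.transGen_of_cover hS h' hw hv)

/-- The bottom place of the new line comes from a place above a bottom place of the same face, and
chains of the new line come from chains of the old one. -/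
theorem grounded_of_cont (T : S.Transition X X' lo up C) (hS : S.Valid) {F : Φ} {v v' : V}
    (hC : C v v') (h : S.Grounded F X' v') : S.Grounded F X v := by
  obtain ⟨b', hb', hbv⟩ := h
  obtain ⟨b, hb⟩ := T.surj b' hb'.1
  have hg : S.Grounded F X b := by
    rcases T.exists_cover_or_bottom hS hb with ⟨t, t', ht, htv, hc⟩ | ⟨F', c, hcb, hc, hcb'⟩
    · exact (hS.not_cover_of_bottom hb' hc).elim
    · obtain rfl : F = F' := hb'.2.1.1.symm.trans hcb'.2.1.1
      exact ⟨c, hc, hcb⟩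
  obtain ⟨c, hc, hcb⟩ := hg
  refine ⟨c, hc, hcb.trans ?_⟩
  rcases reflTransGen_iff_eq_or_transGen.1 hbv with rfl | h
  · rw [T.left_unique _ _ _ hC hb]
  · exact (T.transGen_of_transGen hS h hb hC).to_reflTransGen

theorem grounded_cont (T : S.Transition X X' lo up C) (hS : S.Valid) {F : Φ} {v v' : V}
    (hC : C v v') (h : S.Grounded F X v) : S.Grounded F X' v' := by
  obtain ⟨b, hb, hbv⟩ := h
  -- The predecessor of `v'` may continue a place far below `v`, so the induction up the chain from
  -- `b` has to treat all continuing places at or below the current one.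
  have key : ∀ u u', ReflTransGen (S.Cover X) u v → C u u' → S.Grounded F X' u' := by
    clear hC
    have bot : ∀ w u', C w u' → ReflTransGen (S.Cover X) b w → (∃ F b',
        ReflTransGen (S.Cover X) b' w ∧ S.Bottom F X b' ∧ S.Bottom F X' u') →
        S.Grounded F X' u' := by
      rintro w u' hw hbw ⟨F', b', h1, h2, h3⟩
      -- Predecessors are unique, so the chains from `b` and `b'` to `w` are nested, and nothing is
      -- covered by a bottom place.
      have hbb : b' = b := by
        have hno : ∀ {F c}, S.Bottom F X c → ∀ {e}, ReflTransGen (S.Cover X) e c → e = c := by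
          intro F c hc e he
          rcases ReflTransGen.cases_tail he with rfl | ⟨t, -, ht⟩
          · rfl
          · exact (hS.not_cover_of_bottom hc ht).elim
        have ht := ReflTransGen.total_of_right_unique (r := Function.swap (S.Cover X))
          (fun _ _ _ => hS.cover_left_unique) (reflTransGen_swap.2 h1) (reflTransGen_swap.2 hbw)
        rcases ht with ht | ht
        · exact (hno h2 (reflTransGen_swap.1 ht)).symm
        · exact hno hb (reflTransGen_swap.1 ht)
      subst hbb
      obtain rfl : F' = F := h2.2.1.1.symm.trans hb.2.1.1
      exact ⟨u', h3, .refl⟩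
    induction hbv with
    | refl =>
      intro u u' hu hC
      have hu : u = b := by
        rcases ReflTransGen.cases_tail hu with rfl | ⟨t, -, ht⟩
        · rfl
        · exact (hS.not_cover_of_bottom hb ht).elim
      subst hu
      rcases T.exists_cover_or_bottom hS hC with ⟨t, t', ht, htv, hc⟩ | h
      · obtain ⟨c, -, hcb⟩ := TransGen.tail'_iff.1 htv
        exact (hS.not_cover_of_bottom hb hcb).elim
      · exact bot _ _ hC .refl h
    | @tail w z hbw hwz ih =>
      intro u u' hu hC
      rcases reflTransGen_iff_eq_or_transGen.1 hu with h | h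
      · subst h
        rcases T.exists_cover_or_bottom hS hC with ⟨t, t', ht, htv, hc⟩ | h
        · obtain ⟨c, hc1, hc2⟩ := ih t t' (hS.cover_cases htv hwz) ht
          exact ⟨c, hc1, hc2.tail hc⟩
        · exact bot _ _ hC (hbw.tail hwz) h
      · exact ih u u' (hS.cover_cases h hwz) hC
  exact key v v' .refl hC

end Transition

/-- The transition to the right. -/
theorem Valid.transition_right (hS : S.Valid) (hX : X < X')
    (hno : ∀ v, X < S.x v → X' < S.x v) :
    S.Transition X X' (fun v => S.quad v 3) (fun v => S.quad v 0)
      (fun u u' => u = u' ∧ S.Place X' u) := by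
  have hplace : ∀ u, S.Place X' u → S.Place X u ∧ S.x u < X' := by
    intro u hu
    rcases hu with hu | ⟨hu, d, rfl, h1, h2⟩
    · linarith [hno u (by linarith)]
    · refine ⟨?_, hu⟩
      rcases lt_trichotomy (S.x d.fst) X with h | h | h
      · exact Or.inr ⟨h, d, rfl, h1, by linarith⟩
      · exact Or.inl h
      · linarith [hno _ h]
  refine ⟨?_, ?_, ?_, ?_, ?_, ?_, ?_⟩
  · rintro u v (⟨d, rfl, rfl, hd, hx⟩ | ⟨F, hu, hv, hU, hL, huv, hb⟩)
    · have h3 : S.quad d.snd 3 = S.left d.symm := by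
        rw [hS.left_symm_eq_quad_snd, hd]; rfl
      have hi : S.Inc (S.quad d.snd 3) d := Or.inr h3.symm
      refine ⟨?_, Or.inl ⟨hx, hS.on_fst hi⟩, hS.y_up _ d hd hi, ?_⟩
      · rw [h3]; exact hS.quad_sub_eq_of_fst rfl hd (by decide)
      · rintro w (⟨hw, hw'⟩ | ⟨hw, e, rfl, he, hX, hi'⟩) h1 h2
        · exact hS.up_vertex _ d w hd hi hw' (hw.trans hx.symm) h1 h2
        · exact hS.right_up _ e d he hd hi' hi (by linarith) (by linarith) h1 h2
    · obtain rfl := hL.1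
      exact ⟨hU.1, hu, huv, hb⟩
  · exact fun F v hv => hv.2.1.1
  · intro u hu hC
    -- A place ends at the line only at a vertex without an edge to the right; its two quadrants on
    -- the right then belong to one face.
    refine (hS.quad_of_no_dart u 0 fun d hd h0 => hC u ⟨rfl, ?_⟩).symm
    subst hd
    have hx : S.x d.fst < X' := by
      rcases hu with h | ⟨h, -⟩ <;> linarith
    refine Or.inr ⟨hx, d, rfl, h0, hno _ ?_⟩
    rcases hu with h | ⟨h, e, he, he0, heX⟩
    · linarith [hS.x_right d h0]
    · rwa [← hS.fst_inj he (he0.trans h0.symm)]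
  · rintro u _ ⟨rfl, hu⟩
    exact ⟨(hplace u hu).1, hu, (hplace u hu).2, rfl, rfl, rfl, rfl⟩
  · intro F w hw
    refine ⟨w, ⟨rfl, hw.place⟩, ?_, rfl⟩
    rcases hw with ⟨hw, -⟩ | ⟨hw, d, rfl, hd, hX', hi⟩
    · linarith [hno w (by linarith)]
    · rcases lt_trichotomy (S.x d.fst) X with h | h | h
      · exact Or.inr ⟨h, d, rfl, hd, by linarith, hi⟩
      · exact Or.inl ⟨h, hS.on_fst hi⟩
      · linarith [hno _ h]
  · exact fun w hw => ⟨w, rfl, hw⟩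
  · rintro u v w ⟨rfl, -⟩ ⟨rfl, -⟩
    rfl

/-- The place `u` on the line at `X` continues to the left as the place `u'`. -/
def ContLeft (S : OrthoData G Φ) (X : ℝ) (u u' : V) : Prop :=
  (u = u' ∧ S.x u < X ∧ S.Place X u) ∨
    ∃ d : G.Dart, d.fst = u' ∧ d.snd = u ∧ S.dir d = 0 ∧ S.x u = X

open Classical in
/-- The transition to the left. -/
theorem Valid.transition_left (hS : S.Valid) (hX : X' < X)
    (hno : ∀ v, S.x v < X → S.x v < X') :
    S.Transition X X' (fun v => if S.x v = X then S.quad v 2 else S.quad v 3)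
      (fun v => if S.x v = X then S.quad v 1 else S.quad v 0) (S.ContLeft X) := by
  refine ⟨?_, ?_, ?_, ?_, ?_, ?_, ?_⟩
  · rintro u v (⟨d, rfl, rfl, hd, hx⟩ | ⟨F, hu, hv, hU, hL, huv, hb⟩)
    · have hx' : S.x d.snd = X := by rw [← hS.x_up d hd, hx]
      simp only [if_pos hx, if_pos hx']
      have h2 : S.quad d.snd 2 = S.left d := by
        rw [hS.left_eq_quad_snd, hd]; rfl
      have hi : S.Inc (S.quad d.snd 2) d := Or.inl h2.symm
      refine ⟨?_, Or.inl ⟨hx, hS.on_fst hi⟩, hS.y_up _ d hd hi, ?_⟩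
      · rw [h2, left, hd]
      · rintro w (⟨hw, hw'⟩ | ⟨hw, e, rfl, he, hX, hi'⟩) h1 h2
        · exact hS.up_vertex _ d w hd hi hw' (hw.trans hx.symm) h1 h2
        · exact hS.right_up _ e d he hd hi' hi (by linarith) (by linarith) h1 h2
    · have h1 : (if S.x u = X then S.quad u 1 else S.quad u 0) = F := by
        split_ifs with h
        · exact (hU.2 h).1
        · exact hU.1
      have h2 : (if S.x v = X then S.quad v 2 else S.quad v 3) = F := by
        split_ifs with h
        · exact (hL.2 h).1
        · exact hL.1
      simp only [h1, h2]
      exact ⟨trivial, hu, huv, hb⟩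
  · intro F v hv
    split_ifs with h
    · exact (hv.2.1.2 h).1
    · exact hv.2.1.1
  · intro u hu hC
    have hx : S.x u = X := by
      rcases hu with h | h
      · exact h
      · exact (hC u (Or.inl ⟨rfl, h.1, Or.inr h⟩)).elim
    simp only [if_pos hx]
    -- Only a vertex without an edge to the left fails to continue; its two quadrants on the left
    -- then belong to one face.
    refine hS.quad_of_no_dart u 2 fun d hd h2 => hC d.snd (Or.inr ⟨d.symm, rfl, hd, ?_, hx⟩)
    rw [hS.dir_symm, h2]; decide
  · rintro u u' (⟨rfl, hx, hu⟩ | ⟨d, rfl, rfl, hd, hx⟩)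
    · simp only [if_neg hx.ne]
      refine ⟨hu, ?_, hno _ hx, trivial, trivial, trivial, trivial⟩
      rcases hu with h | ⟨h, d, rfl, h1, h2⟩
      · linarith
      · exact Or.inr ⟨hno _ h, d, rfl, h1, by linarith⟩
    · have hlt := hno d.fst (by linarith [hS.x_right d hd])
      have h1 : S.left d = S.quad d.snd 1 := by rw [hS.left_eq_quad_snd, hd]; rfl
      have h2 : S.left d.symm = S.quad d.snd 2 := by rw [hS.left_symm_eq_quad_snd, hd]; rfl
      simp only [if_pos hx]
      refine ⟨Or.inl hx, Or.inr ⟨hlt, d, rfl, hd, by linarith⟩, hlt, ?_, ?_,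
        hS.y_right _ d hd (Or.inl h1), hS.y_right _ d hd (Or.inr h2)⟩
      · rw [← h1, left, hd]
      · rw [← h2]; exact hS.quad_sub_eq_of_fst rfl hd (by decide)
  · rintro F w (⟨hw, -⟩ | ⟨hw, d, rfl, hd, hX', hi⟩)
    · linarith [hno w (by linarith)]
    · rcases lt_trichotomy (S.x d.snd) X with h | h | h
      · linarith [hno _ h]
      · exact ⟨d.snd, Or.inr ⟨d, rfl, rfl, hd, h⟩, Or.inl ⟨h, hS.on_snd hi⟩,
          (hS.y_right F d hd hi).symm⟩
      · have hr : S.Rel F X d.fst := Or.inr ⟨by linarith, d, rfl, hd, h, hi⟩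
        exact ⟨d.fst, Or.inl ⟨rfl, by linarith, hr.place⟩, hr, rfl⟩
  · rintro w (hw | ⟨hw, d, rfl, hd, hX'⟩)
    · linarith [hno w (by linarith)]
    · rcases lt_trichotomy (S.x d.snd) X with h | h | h
      · linarith [hno _ h]
      · exact ⟨d.snd, Or.inr ⟨d, rfl, rfl, hd, h⟩⟩
      · exact ⟨d.fst, Or.inl ⟨rfl, by linarith, Or.inr ⟨by linarith, d, rfl, hd, h⟩⟩⟩
  · rintro u v w (⟨rfl, hx, hu⟩ | ⟨d, rfl, rfl, hd, hx⟩) (⟨rfl, hx', hu'⟩ | ⟨d', hdd, rfl, hd', hx'⟩)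
    · rfl
    · rcases hu with hu | ⟨-, e, he, he0, heX⟩
      · linarith
      · rw [hS.fst_inj (he.trans hdd.symm) (he0.trans hd'.symm)] at heX
        linarith
    · rcases hu' with hu | ⟨-, e, he, he0, heX⟩
      · linarith
      · rw [hS.fst_inj he (he0.trans hd.symm)] at heX
        linarith
    · rw [hS.fst_inj hdd (hd'.trans hd.symm)]

end OrthoData

/-! ### Every vertical line carries a single chain -/

namespace OrthoData

open Relation Filter Topology

variable {V : Type*} {G : SimpleGraph V} {Φ : Type*} [Fintype V] [DecidableRel G.Adj]
  [DecidableEq Φ] {S : OrthoData G Φ} {X X' : ℝ}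

theorem eventually_gap (S : OrthoData G Φ) (X : ℝ) :
    ∀ᶠ X' in 𝓝 X, ∀ v, (X < S.x v → X' < S.x v) ∧ (S.x v < X → S.x v < X') := by
  rw [eventually_all]
  intro v
  refine Filter.Eventually.and ?_ ?_
  · by_cases h : X < S.x v
    · filter_upwards [eventually_lt_nhds h] with X' h' _ using h'
    · exact Filter.Eventually.of_forall fun _ h' => (h h').elim
  · by_cases h : S.x v < X
    · filter_upwards [eventually_gt_nhds h] with X' h' _ using h'
    · exact Filter.Eventually.of_forall fun _ h' => (h h').elim

namespace Valid

/-- Groundedness of the edge is locally constant in the position of the line, by one transition to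
the right or to the left, and the interval is connected. -/
theorem grounded_iff_of_mem_Ico (hS : S.Valid) {F : Φ} {d : G.Dart} (hd : S.dir d = 0)
    (hX : X ∈ Set.Ico (S.x d.fst) (S.x d.snd)) (hX' : X' ∈ Set.Ico (S.x d.fst) (S.x d.snd)) :
    S.Grounded F X d.fst ↔ S.Grounded F X' d.fst := by
  have hplace : ∀ Z ∈ Set.Ico (S.x d.fst) (S.x d.snd), S.Place Z d.fst := by
    intro Z hZ
    rcases hZ.1.lt_or_eq with h | h
    · exact Or.inr ⟨h, d, rfl, hd, hZ.2⟩
    · exact Or.inl h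
  refine isPreconnected_Ico.induction₂' (fun X X' => S.Grounded F X d.fst ↔ S.Grounded F X' d.fst)
    (fun Z hZ => ?_) (fun _ _ _ _ _ _ h1 h2 => h1.trans h2) hX hX'
  filter_upwards [mem_nhdsWithin_of_mem_nhds (S.eventually_gap Z), self_mem_nhdsWithin]
    with Z' hgap hZ'
  rw [iff_comm (a := S.Grounded F Z' d.fst), and_self]
  rcases lt_trichotomy Z Z' with h | rfl | h
  · have T := hS.transition_right h fun v => (hgap v).1
    exact ⟨T.grounded_cont hS ⟨rfl, hplace _ hZ'⟩, T.grounded_of_cont hS ⟨rfl, hplace _ hZ'⟩⟩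
  · rfl
  · have T := hS.transition_left h fun v => (hgap v).2
    have hC : S.ContLeft Z d.fst d.fst := Or.inl ⟨rfl, by linarith [hZ'.1], hplace _ hZ⟩
    exact ⟨T.grounded_cont hS hC, T.grounded_of_cont hS hC⟩

theorem grounded_right_iff (hS : S.Valid) {F : Φ} {d : G.Dart} (hd : S.dir d = 0) :
    S.Grounded F (S.x d.fst) d.fst ↔ S.Grounded F (S.x d.snd) d.snd := by
  have hx := hS.x_right d hd
  obtain ⟨Z, hgap, hZ⟩ := ((mem_nhdsWithin_of_mem_nhds (S.eventually_gap (S.x d.snd)) :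
    _ ∈ 𝓝[<] (S.x d.snd)) |> fun h => (Filter.inter_mem h self_mem_nhdsWithin) |>
      Filter.nonempty_of_mem)
  have T := hS.transition_left hZ fun v => (hgap v).2
  have hC : S.ContLeft (S.x d.snd) d.snd d.fst := Or.inr ⟨d, rfl, rfl, hd, rfl⟩
  rw [hS.grounded_iff_of_mem_Ico hd ⟨le_rfl, hx⟩ ⟨((hgap d.fst).2 hx).le, hZ⟩]
  exact ⟨T.grounded_of_cont hS hC, T.grounded_cont hS hC⟩

theorem grounded_of_cover (hS : S.Valid) {F : Φ} {u v : V} (h : S.Cover X u v) :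
    S.Grounded F X u ↔ S.Grounded F X v := by
  constructor
  · rintro ⟨b, hb, hbu⟩
    exact ⟨b, hb, hbu.tail h⟩
  · rintro ⟨b, hb, hbv⟩
    rcases ReflTransGen.cases_tail hbv with rfl | ⟨c, hbc, hcv⟩
    · exact (hS.not_cover_of_bottom hb h).elim
    · rw [hS.cover_left_unique h hcv]
      exact ⟨b, hb, hbc⟩

theorem grounded_dart_iff (hS : S.Valid) {F : Φ} (d : G.Dart) :
    S.Grounded F (S.x d.fst) d.fst ↔ S.Grounded F (S.x d.snd) d.snd := by
  wlog h : S.dir d = 0 ∨ S.dir d = 1 generalizing d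
  · exact (this d.symm ((hS.dir_cases d).resolve_left h)).symm
  rcases h with h | h
  · exact hS.grounded_right_iff h
  · rw [← hS.x_up d h]
    exact hS.grounded_of_cover (Or.inl ⟨d, rfl, rfl, h, rfl⟩)

/-- All places on all vertical lines are reached from the outer face. -/
theorem exists_grounded (hS : S.Valid) (hconn : G.Connected) :
    ∃ F, ∀ X v, S.Place X v → S.Grounded F X v := by
  classical
  have := hconn.nonempty
  obtain ⟨v₀, -, hmin⟩ := Finset.exists_min_image Finset.univ S.x Finset.univ_nonempty
  -- There is no place to the left of a leftmost vertex, so nothing continues there and the descent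
  -- from `v₀` can only end at a bottom place. Any position further left would do.
  have T := hS.transition_left (X := S.x v₀) (X' := S.x v₀ - 1) (by linarith)
    (fun v hv => absurd (hmin v (Finset.mem_univ _)) (not_le.2 hv))
  obtain ⟨F, hF⟩ : ∃ F, S.Grounded F (S.x v₀) v₀ := by
    rcases T.exists_lower_cont hS _ (Or.inl rfl : S.Place _ v₀) rfl rfl with
      ⟨u, u', hu, -⟩ | ⟨b, h1, h2, -⟩
    · linarith [(T.cont u u' hu).2.2.1, hmin u' (Finset.mem_univ _)]
    · exact ⟨_, b, h2, h1⟩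
  have hv : ∀ v, S.Grounded F (S.x v) v := fun v =>
    (RotationSystem.eq_const_of_adj hconn (fun v => S.Grounded F (S.x v) v)
      (fun d => propext (hS.grounded_dart_iff d)) v₀ v) ▸ hF
  refine ⟨F, fun X v hX => ?_⟩
  rcases hX with rfl | ⟨hX, d, rfl, hd, hX'⟩
  · exact hv v
  · exact (hS.grounded_iff_of_mem_Ico hd ⟨le_rfl, hS.x_right d hd⟩ ⟨hX.le, hX'⟩).1 (hv _)

/-- Since predecessors are unique, a cycle through `v` contains the whole chain down to the bottom
place, which has no predecessor. -/
theorem transGen_irrefl (hS : S.Valid) (hconn : G.Connected) (v : V) :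
    ¬ TransGen (S.Cover X) v v := by
  intro h
  obtain ⟨c, -, hcv⟩ := TransGen.tail'_iff.1 h
  obtain ⟨F, hF⟩ := hS.exists_grounded hconn
  obtain ⟨b, hb, hbv⟩ := hF X v (hS.cover_place hcv).2
  clear hcv
  induction hbv with
  | refl =>
    obtain ⟨c, -, hcv⟩ := TransGen.tail'_iff.1 h
    exact hS.not_cover_of_bottom hb hcv
  | tail _ hwz ih => exact ih (TransGen.head' hwz (hS.cover_cases h hwz))

/-- Both places are reached from the unique bottom place of `F` by unique successors, so one is
reached from the other. -/
theorem transGen_total (hS : S.Valid) (hconn : G.Connected) {u v : V} (hu : S.Place X u)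
    (hv : S.Place X v) (hne : u ≠ v) : TransGen (S.Cover X) u v ∨ TransGen (S.Cover X) v u := by
  obtain ⟨F, hF⟩ := hS.exists_grounded hconn
  obtain ⟨b, hb, hbu⟩ := hF X u hu
  obtain ⟨b', hb', hbv⟩ := hF X v hv
  obtain rfl := hS.bottom_unique hb hb'
  have := ReflTransGen.total_of_right_unique (r := S.Cover X)
    (fun _ _ _ h h' => hS.cover_right_unique h h') hbu hbv
  simpa [reflTransGen_iff_eq_or_transGen, hne, hne.symm] using this

/-- Transitions pull chains back; since the orders are total and irreflexive, they preserve them as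
well. -/
theorem transGen_iff_of_transition (hS : S.Valid) (hconn : G.Connected) {lo up : V → Φ}
    {C : V → V → Prop} (T : S.Transition X X' lo up C) {u v u' v' : V} (hu : C u u')
    (hv : C v v') : TransGen (S.Cover X) u v ↔ TransGen (S.Cover X') u' v' := by
  refine ⟨fun h => ?_, fun h => T.transGen_of_transGen hS h hu hv⟩
  have hne : u' ≠ v' := by
    rintro rfl
    rw [T.left_unique _ _ _ hu hv] at h
    exact hS.transGen_irrefl hconn _ h
  refine (hS.transGen_total hconn (T.cont _ _ hu).2.1 (T.cont _ _ hv).2.1 hne).resolve_right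
    fun h' => ?_
  exact hS.transGen_irrefl hconn _ (h.trans (T.transGen_of_transGen hS h' hv hu))

/-- For common ordinates nothing has to be chosen: each covering step goes up in the drawing of some
face. -/
theorem transGen_le (hS : S.Valid) {y : V → ℝ} (hy : ∀ F v, S.y F v = y v) {u v : V}
    (h : TransGen (S.Cover X) u v) : y u < y v := by
  have key : ∀ u v, S.Cover X u v → y u < y v := by
    rintro u v (⟨d, rfl, rfl, hd, -⟩ | ⟨F, -, -, -, -, h, -⟩)
    · have := hS.y_up _ d hd (Or.inl rfl)
      rwa [hy, hy] at this
    · rwa [hy, hy] at h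
  induction h with
  | single h => exact key _ _ h
  | tail _ h ih => exact ih.trans (key _ _ h)

end Valid

/-! ### Heights for the maximal horizontal segments -/

/-- Members of a family of compact intervals, with an irreflexive relation that is
transitive on the members through each point, can be given compatible heights. -/
theorem _root_.exists_height_of_intervals {I : Type*} [Finite I] (l r : I → ℝ) (R : I → I → Prop)
    (irrefl : ∀ i, ¬ R i i)
    (trans : ∀ X i j k, X ∈ Set.Icc (l i) (r i) → X ∈ Set.Icc (l j) (r j) →
      X ∈ Set.Icc (l k) (r k) → R i j → R j k → R i k) :
    ∃ y : I → ℝ, ∀ X i j, X ∈ Set.Icc (l i) (r i) → X ∈ Set.Icc (l j) (r j) → R i j →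
      y i < y j := by
  classical
  have := Fintype.ofFinite I
  suffices h : ∀ s : Finset I, ∃ y : I → ℝ, ∀ X, ∀ i ∈ s, ∀ j ∈ s, X ∈ Set.Icc (l i) (r i) →
      X ∈ Set.Icc (l j) (r j) → R i j → y i < y j by
    obtain ⟨y, hy⟩ := h Finset.univ
    exact ⟨y, fun X i j => hy X i (Finset.mem_univ _) j (Finset.mem_univ _)⟩
  intro s
  -- Intervals are inserted by increasing left end. Those already present that meet the new interval
  -- all contain its left end, so the relation is transitive among them there and leaves room for a
  -- value between the ones below and the ones above.
  induction s using Finset.induction_on_max_value l with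
  | empty => exact ⟨0, by simp⟩
  | insert i s his hmax ih =>
    obtain ⟨y, hy⟩ := ih
    by_cases hi : l i ≤ r i
    · obtain ⟨m, hm1, hm2⟩ := Order.exists_between_finsets
        ((s.filter fun j => l i ≤ r j ∧ R j i).image y)
        ((s.filter fun j => l i ≤ r j ∧ R i j).image y) (by
          intro a ha b hb
          simp only [Finset.mem_image, Finset.mem_filter] at ha hb
          obtain ⟨j, ⟨hj, hj1, hj2⟩, rfl⟩ := ha
          obtain ⟨k, ⟨hk, hk1, hk2⟩, rfl⟩ := hb
          exact hy (l i) j hj k hk ⟨hmax j hj, hj1⟩ ⟨hmax k hk, hk1⟩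
            (trans (l i) j i k ⟨hmax j hj, hj1⟩ ⟨le_rfl, hi⟩ ⟨hmax k hk, hk1⟩ hj2 hk2))
      have hne : ∀ j ∈ s, j ≠ i := fun j hj h => his (h ▸ hj)
      refine ⟨Function.update y i m, fun X a ha' b hb' hXa hXb hab => ?_⟩
      rcases Finset.mem_insert.1 ha' with rfl | ha <;> rcases Finset.mem_insert.1 hb' with rfl | hb
      · exact (irrefl _ hab).elim
      · rw [Function.update_self, Function.update_of_ne (hne b hb)]
        exact hm2 _ (Finset.mem_image_of_mem _
          (Finset.mem_filter.2 ⟨hb, hXa.1.trans hXb.2, hab⟩))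
      · rw [Function.update_self, Function.update_of_ne (hne a ha)]
        exact hm1 _ (Finset.mem_image_of_mem _
          (Finset.mem_filter.2 ⟨ha, hXb.1.trans hXa.2, hab⟩))
      · rw [Function.update_of_ne (hne a ha), Function.update_of_ne (hne b hb)]
        exact hy X a ha b hb hXa hXb hab
    · refine ⟨y, fun X a ha b hb hXa hXb hab => ?_⟩
      rcases Finset.mem_insert.1 ha with rfl | ha
      · exact (hi (hXa.1.trans hXa.2)).elim
      rcases Finset.mem_insert.1 hb with rfl | hb
      · exact (hi (hXb.1.trans hXb.2)).elim
      exact hy X a ha b hb hXa hXb hab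

/-- The vertex `v` is the right neighbour of the vertex `u`. -/
def RightNext (S : OrthoData G Φ) (u v : V) : Prop :=
  ∃ d : G.Dart, d.fst = u ∧ d.snd = v ∧ S.dir d = 0

namespace Valid

/-- Left and right neighbours are unique, so a class of `Quot S.RightNext`, a maximal horizontal
segment, is a chain. -/
theorem reflTransGen_or_of_eq (hS : S.Valid) {u v : V}
    (h : Quot.mk S.RightNext u = Quot.mk S.RightNext v) :
    ReflTransGen S.RightNext u v ∨ ReflTransGen S.RightNext v u := by
  have ru : ∀ u v w, S.RightNext u v → S.RightNext u w → v = w := by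
    rintro u v w ⟨d, rfl, rfl, hd⟩ ⟨e, he, rfl, he0⟩
    rw [hS.fst_inj he (he0.trans hd.symm)]
  have lu : ∀ u v w, S.RightNext u w → S.RightNext v w → u = v := by
    rintro u v w ⟨d, rfl, rfl, hd⟩ ⟨e, rfl, he, he0⟩
    rw [hS.snd_inj he (he0.trans hd.symm)]
  have key : ∀ u v w, ReflTransGen S.RightNext u v → ReflTransGen S.RightNext u w →
      ReflTransGen S.RightNext v w ∨ ReflTransGen S.RightNext w v := fun u v w h1 h2 =>
    ReflTransGen.total_of_right_unique (fun u v w => ru u v w) h1 h2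
  have key' : ∀ u v w, ReflTransGen S.RightNext v u → ReflTransGen S.RightNext w u →
      ReflTransGen S.RightNext v w ∨ ReflTransGen S.RightNext w v := fun u v w h1 h2 => by
    have := ReflTransGen.total_of_right_unique (r := Function.swap S.RightNext)
      (fun u v w h h' => lu v w u h h') (reflTransGen_swap.2 h1) (reflTransGen_swap.2 h2)
    exact (this.imp reflTransGen_swap.1 reflTransGen_swap.1).symm
  have h' := Quot.eqvGen_exact h
  clear h
  induction h' with
  | rel u v h => exact Or.inl (.single h)
  | refl => exact Or.inl .refl
  | symm u v h ih => exact ih.symm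
  | trans u v w h h' ih ih' =>
    rcases ih with k | k <;> rcases ih' with k' | k'
    · exact Or.inl (k.trans k')
    · exact key' _ _ _ k k'
    · exact key _ _ _ k k'
    · exact Or.inr (k'.trans k)

theorem x_le_of_reflTransGen (hS : S.Valid) {u v : V} (h : ReflTransGen S.RightNext u v) :
    S.x u ≤ S.x v := by
  induction h with
  | refl => exact le_rfl
  | tail _ h ih =>
    obtain ⟨d, rfl, rfl, hd⟩ := h
    exact ih.trans (hS.x_right d hd).le

theorem _root_.OrthoData.Place.x_le {u : V} (hu : S.Place X u) : S.x u ≤ X := by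
  rcases hu with h | h
  · exact h.le
  · exact h.1.le

theorem lt_snd_of_place (hS : S.Valid) {d : G.Dart} (hd : S.dir d = 0)
    (hu : S.Place X d.fst) : X < S.x d.snd := by
  rcases hu with h | ⟨h, e, he, he0, heX⟩
  · exact h ▸ hS.x_right d hd
  · rwa [← hS.fst_inj he (he0.trans hd.symm)]

/-- A horizontal segment meets a vertical line in at most one place. -/
theorem place_unique (hS : S.Valid) {u v : V} (hu : S.Place X u) (hv : S.Place X v)
    (h : Quot.mk S.RightNext u = Quot.mk S.RightNext v) : u = v := by
  wlog h' : ReflTransGen S.RightNext u v generalizing u v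
  · exact (this hv hu h.symm ((hS.reflTransGen_or_of_eq h).resolve_left h')).symm
  rcases ReflTransGen.cases_head h' with rfl | ⟨c, ⟨d, rfl, rfl, hd⟩, hcv⟩
  · rfl
  · linarith [hS.x_le_of_reflTransGen hcv, hv.x_le, hS.lt_snd_of_place hd hu]

/-- A horizontal segment meets all vertical lines between any two of its vertices. -/
theorem exists_place (hS : S.Valid) {u v : V}
    (h : Quot.mk S.RightNext u = Quot.mk S.RightNext v) (hu : S.x u ≤ X) (hv : X ≤ S.x v) :
    ∃ w, Quot.mk S.RightNext w = Quot.mk S.RightNext v ∧ S.Place X w := by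
  rcases hS.reflTransGen_or_of_eq h with h' | h'
  · clear h
    induction h' using ReflTransGen.head_induction_on with
    | refl => exact ⟨v, rfl, Or.inl (le_antisymm hu hv)⟩
    | @head a c hac hcv ih =>
      by_cases hc : S.x c ≤ X
      · exact ih hc
      · have h1 : Quot.mk S.RightNext a = Quot.mk S.RightNext v :=
          Quot.eqvGen_sound (EqvGen.trans _ _ _ (.rel _ _ hac)
            (EqvGen.reflTransGen_le_eqvGen S.RightNext _ _ hcv))
        obtain ⟨d, rfl, rfl, hd⟩ := hac
        refine ⟨d.fst, h1, ?_⟩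
        rcases hu.lt_or_eq with h | h
        · exact Or.inr ⟨h, d, rfl, hd, not_le.1 hc⟩
        · exact Or.inl h
  · have := hS.x_le_of_reflTransGen h'
    exact ⟨v, rfl, Or.inl (by linarith)⟩

end Valid

end OrthoData

namespace OrthoData

open Relation Filter Topology

variable {V : Type*} {G : SimpleGraph V} {Φ : Type*} [Fintype V] [DecidableRel G.Adj]
  [DecidableEq Φ] {S : OrthoData G Φ} {X X' : ℝ}

namespace Valid

/-- The vertical order of two horizontal segments is the same on all lines meeting both. -/
theorem transGen_iff_of_eq (hS : S.Valid) (hconn : G.Connected) {u v u' v' : V}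
    (hu : S.Place X u) (hv : S.Place X v) (hu' : S.Place X' u') (hv' : S.Place X' v')
    (huu : Quot.mk S.RightNext u' = Quot.mk S.RightNext u)
    (hvv : Quot.mk S.RightNext v' = Quot.mk S.RightNext v) :
    TransGen (S.Cover X) u v ↔ TransGen (S.Cover X') u' v' := by
  have hright : ∀ {Z w}, S.Place Z w → ∃ w', Quot.mk S.RightNext w' = Quot.mk S.RightNext w ∧
      Z ≤ S.x w' := by
    rintro Z w (h | ⟨-, d, rfl, h0, h1⟩)
    · exact ⟨w, rfl, h.ge⟩
    · exact ⟨d.snd, (Quot.sound ⟨d, rfl, rfl, h0⟩).symm, h1.le⟩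
  have hconv : ∀ {Z a a'}, S.Place X a → S.Place X' a' →
      Quot.mk S.RightNext a' = Quot.mk S.RightNext a → Z ∈ Set.uIcc X X' →
      ∃ w, Quot.mk S.RightNext w = Quot.mk S.RightNext a ∧ S.Place Z w := by
    intro Z a a' ha ha' h hZ
    obtain ⟨b, hb, hxb⟩ := hright ha
    obtain ⟨b', hb', hxb'⟩ := hright ha'
    have h1 := ha.x_le
    have h2 := ha'.x_le
    rcases le_total X X' with hX | hX
    · rw [Set.uIcc_of_le hX] at hZ
      obtain ⟨w, hw, hp⟩ := hS.exists_place (h.symm.trans hb'.symm) (h1.trans hZ.1)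
        (hZ.2.trans hxb')
      exact ⟨w, hw.trans (hb'.trans h), hp⟩
    · rw [Set.uIcc_of_ge hX] at hZ
      obtain ⟨w, hw, hp⟩ := hS.exists_place (h.trans hb.symm) (h2.trans hZ.1)
        (hZ.2.trans hxb)
      exact ⟨w, hw.trans hb, hp⟩
  -- By `hconv` both segments meet every line between `X` and `X'`; so the comparison is extended
  -- over this connected interval by local transitions.
  have main := isPreconnected_uIcc.induction₂' (s := Set.uIcc X X')
    (fun Z Z' => ∀ a b a' b', S.Place Z a → S.Place Z b → S.Place Z' a' → S.Place Z' b' →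
      Quot.mk S.RightNext a = Quot.mk S.RightNext u → Quot.mk S.RightNext b = Quot.mk S.RightNext v →
      Quot.mk S.RightNext a' = Quot.mk S.RightNext u →
      Quot.mk S.RightNext b' = Quot.mk S.RightNext v →
      (TransGen (S.Cover Z) a b ↔ TransGen (S.Cover Z') a' b'))
    (fun Z _ => ?_) (fun Z Z' Z'' _ hZ' _ h1 h2 a b a'' b'' ha hb ha' hb' k1 k2 k3 k4 => ?_)
    Set.left_mem_uIcc Set.right_mem_uIcc
  · exact main u v u' v' hu hv hu' hv' rfl rfl huu hvv
  · filter_upwards [mem_nhdsWithin_of_mem_nhds (S.eventually_gap Z)] with Z' hgap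
    have key : ∀ a b a' b', S.Place Z a → S.Place Z b → S.Place Z' a' → S.Place Z' b' →
        Quot.mk S.RightNext a = Quot.mk S.RightNext a' →
        Quot.mk S.RightNext b = Quot.mk S.RightNext b' →
        (TransGen (S.Cover Z) a b ↔ TransGen (S.Cover Z') a' b') := by
      intro a b a' b' ha hb ha' hb' h h'
      rcases lt_trichotomy Z Z' with hlt | rfl | hlt
      · have T := hS.transition_right hlt fun v => (hgap v).1
        obtain rfl := hS.place_unique ha (T.cont a' a' ⟨rfl, ha'⟩).1 h
        obtain rfl := hS.place_unique hb (T.cont b' b' ⟨rfl, hb'⟩).1 h'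
        exact hS.transGen_iff_of_transition hconn T ⟨rfl, ha'⟩ ⟨rfl, hb'⟩
      · rw [hS.place_unique ha ha' h, hS.place_unique hb hb' h']
      · have T := hS.transition_left hlt fun v => (hgap v).2
        have hc : ∀ {w w'}, S.ContLeft Z w w' →
            Quot.mk S.RightNext w = Quot.mk S.RightNext w' := by
          rintro w w' (⟨rfl, -⟩ | ⟨d, rfl, rfl, h0, -⟩)
          · rfl
          · exact (Quot.sound ⟨d, rfl, rfl, h0⟩).symm
        obtain ⟨c, hca⟩ := T.surj a' ha'
        obtain ⟨c', hcb⟩ := T.surj b' hb'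
        obtain rfl := hS.place_unique ha (T.cont _ _ hca).1 (h.trans (hc hca).symm)
        obtain rfl := hS.place_unique hb (T.cont _ _ hcb).1 (h'.trans (hc hcb).symm)
        exact hS.transGen_iff_of_transition hconn T hca hcb
    exact ⟨fun a b a' b' ha hb ha' hb' k1 k2 k3 k4 =>
        key a b a' b' ha hb ha' hb' (k1.trans k3.symm) (k2.trans k4.symm),
      fun a b a' b' ha hb ha' hb' k1 k2 k3 k4 =>
        (key a' b' a b ha' hb' ha hb (k3.trans k1.symm) (k4.trans k2.symm)).symm⟩
  · obtain ⟨c, hc, hcp⟩ := hconv hu hu' huu hZ'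
    obtain ⟨c', hc', hcp'⟩ := hconv hv hv' hvv hZ'
    exact (h1 a b c c' ha hb hcp hcp' k1 k2 hc hc').trans
      (h2 c c' a'' b'' hcp hcp' ha' hb' hc hc' k3 k4)

/-- There are ordinates compatible with the vertical orders in all faces. -/
theorem exists_height (hS : S.Valid) (hconn : G.Connected) : ∃ y : V → ℝ,
    (∀ d : G.Dart, S.dir d = 0 → y d.fst = y d.snd) ∧
    ∀ X u v, S.Place X u → S.Place X v → TransGen (S.Cover X) u v → y u < y v := by
  classical
  have hl : ∀ H : Quot S.RightNext, ∃ a, Quot.mk S.RightNext a = H ∧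
      ∀ b, Quot.mk S.RightNext b = H → S.x a ≤ S.x b := by
    intro H
    obtain ⟨c, hc⟩ := Quot.exists_rep H
    obtain ⟨a, ha, hmin⟩ := Finset.exists_min_image
      (Finset.univ.filter fun a => Quot.mk S.RightNext a = H) S.x ⟨c, by simpa using hc⟩
    simp only [Finset.mem_filter, Finset.mem_univ, true_and] at ha hmin
    exact ⟨a, ha, hmin⟩
  have hr : ∀ H : Quot S.RightNext, ∃ a, Quot.mk S.RightNext a = H ∧
      ∀ b, Quot.mk S.RightNext b = H → S.x b ≤ S.x a := by
    intro H
    obtain ⟨c, hc⟩ := Quot.exists_rep H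
    obtain ⟨a, ha, hmax⟩ := Finset.exists_max_image
      (Finset.univ.filter fun a => Quot.mk S.RightNext a = H) S.x ⟨c, by simpa using hc⟩
    simp only [Finset.mem_filter, Finset.mem_univ, true_and] at ha hmax
    exact ⟨a, ha, hmax⟩
  choose l hl hlmin using hl
  choose r hr hrmax using hr
  have hmem : ∀ {X v}, S.Place X v → X ∈ Set.Icc (S.x (l (Quot.mk _ v))) (S.x (r (Quot.mk _ v))) := by
    intro X v hv
    refine ⟨(hlmin _ v rfl).trans hv.x_le, ?_⟩
    rcases hv with h | ⟨-, d, rfl, h0, h1⟩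
    · exact h ▸ hrmax _ v rfl
    · exact h1.le.trans (hrmax _ d.snd (Quot.sound ⟨d, rfl, rfl, h0⟩).symm)
  have hplace : ∀ {X H}, X ∈ Set.Icc (S.x (l H)) (S.x (r H)) →
      ∃ w, Quot.mk S.RightNext w = H ∧ S.Place X w := by
    intro X H hX
    obtain ⟨w, hw, hp⟩ := hS.exists_place ((hl H).trans (hr H).symm) hX.1 hX.2
    exact ⟨w, hw.trans (hr H), hp⟩
  -- One segment is below another if it is so on some line. On any line meeting all segments
  -- involved this is the chain order there, which gives transitivity.
  obtain ⟨y, hy⟩ := exists_height_of_intervals (fun H => S.x (l H)) (fun H => S.x (r H))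
    (fun H K => ∃ X u v, Quot.mk S.RightNext u = H ∧ Quot.mk S.RightNext v = K ∧ S.Place X u ∧
      S.Place X v ∧ TransGen (S.Cover X) u v)
    (by
      rintro H ⟨X, u, v, hu, hv, hpu, hpv, h⟩
      rw [hS.place_unique hpu hpv (hu.trans hv.symm)] at h
      exact hS.transGen_irrefl hconn _ h)
    (by
      rintro X H K L hH hK hL ⟨Y, a, b, ha, hb, hpa, hpb, h⟩ ⟨Z, c, d, hc, hd, hpc, hpd, h'⟩
      obtain ⟨a', ha', hpa'⟩ := hplace hH
      obtain ⟨b', hb', hpb'⟩ := hplace hK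
      obtain ⟨d', hd', hpd'⟩ := hplace hL
      rw [hS.transGen_iff_of_eq hconn hpa hpb hpa' hpb' (ha'.trans ha.symm) (hb'.trans hb.symm)]
        at h
      rw [hS.transGen_iff_of_eq hconn hpc hpd hpb' hpd' (hb'.trans hc.symm) (hd'.trans hd.symm)]
        at h'
      exact ⟨X, a', d', ha', hd', hpa', hpd', h.trans h'⟩)
  refine ⟨fun v => y (Quot.mk _ v), fun d hd => congrArg y (Quot.sound ⟨d, rfl, rfl, hd⟩), ?_⟩
  intro X u v hu hv h
  exact hy X _ _ (hmem hu) (hmem hv) ⟨X, u, v, rfl, rfl, hu, hv, h⟩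

theorem eq_of_height_eq (hS : S.Valid) (hconn : G.Connected) {y : V → ℝ}
    (hy : ∀ X u v, S.Place X u → S.Place X v → TransGen (S.Cover X) u v → y u < y v)
    {u v : V} (hu : S.Place X u) (hv : S.Place X v) (h : y u = y v) : u = v := by
  by_contra hne
  rcases hS.transGen_total hconn hu hv hne with h' | h'
  · linarith [hy X u v hu hv h']
  · linarith [hy X v u hv hu h']

/-- By totality the chain leads from `u` up to `w`; its first step is the unique successor `v` of
`u`, so `w` cannot be below `v`. -/
theorem not_between_of_cover (hS : S.Valid) (hconn : G.Connected) {y : V → ℝ}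
    (hy : ∀ X u v, S.Place X u → S.Place X v → TransGen (S.Cover X) u v → y u < y v)
    {u v w : V} (huv : S.Cover X u v) (hw : S.Place X w) (h1 : y u < y w) (h2 : y w < y v) :
    False := by
  obtain ⟨hu, hv⟩ := hS.cover_place huv
  have huw : TransGen (S.Cover X) u w :=
    (hS.transGen_total hconn hu hw (by rintro rfl; exact lt_irrefl _ h1)).resolve_right
      fun h => by linarith [hy X w u hw hu h]
  obtain ⟨c, huc, hcw⟩ := TransGen.head'_iff.1 huw
  obtain rfl := hS.cover_right_unique huv huc
  rcases reflTransGen_iff_eq_or_transGen.1 hcw with rfl | h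
  · exact lt_irrefl _ h2
  · linarith [hy X _ w hv hw h]

end Valid

end OrthoData

/-! ### Planarity of the drawing with compatible heights -/

theorem mem_openSegment_iff_of_im_eq {a b z : ℂ} (h : a.im = b.im) (hlt : a.re < b.re) :
    z ∈ openSegment ℝ a b ↔ z.im = a.im ∧ a.re < z.re ∧ z.re < b.re := by
  rw [openSegment_eq_image_lineMap]
  constructor
  · rintro ⟨t, ⟨h0, h1⟩, rfl⟩
    simp only [AffineMap.lineMap_apply, vsub_eq_sub, vadd_eq_add, Complex.add_im, Complex.add_re,
      Complex.real_smul, Complex.mul_im, Complex.mul_re, Complex.ofReal_re, Complex.ofReal_im,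
      Complex.sub_re, Complex.sub_im, h]
    refine ⟨by ring, by nlinarith, by nlinarith⟩
  · rintro ⟨h1, h2, h3⟩
    refine ⟨(z.re - a.re) / (b.re - a.re), ⟨by apply div_pos <;> linarith, ?_⟩, ?_⟩
    · rw [div_lt_one (by linarith)]; linarith
    · have hne : b.re - a.re ≠ 0 := by linarith
      apply Complex.ext <;>
      simp only [AffineMap.lineMap_apply, vsub_eq_sub, vadd_eq_add, Complex.add_im, Complex.add_re,
        Complex.real_smul, Complex.mul_im, Complex.mul_re, Complex.ofReal_re, Complex.ofReal_im,
        Complex.sub_re, Complex.sub_im, ← h, h1]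
      · field_simp; ring
      · ring

theorem mem_openSegment_iff_of_re_eq {a b z : ℂ} (h : a.re = b.re) (hlt : a.im < b.im) :
    z ∈ openSegment ℝ a b ↔ z.re = a.re ∧ a.im < z.im ∧ z.im < b.im := by
  rw [openSegment_eq_image_lineMap]
  constructor
  · rintro ⟨t, ⟨h0, h1⟩, rfl⟩
    simp only [AffineMap.lineMap_apply, vsub_eq_sub, vadd_eq_add, Complex.add_im, Complex.add_re,
      Complex.real_smul, Complex.mul_im, Complex.mul_re, Complex.ofReal_re, Complex.ofReal_im,
      Complex.sub_re, Complex.sub_im, h]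
    refine ⟨by ring, by nlinarith, by nlinarith⟩
  · rintro ⟨h1, h2, h3⟩
    refine ⟨(z.im - a.im) / (b.im - a.im), ⟨by apply div_pos <;> linarith, ?_⟩, ?_⟩
    · rw [div_lt_one (by linarith)]; linarith
    · have hne : b.im - a.im ≠ 0 := by linarith
      apply Complex.ext <;>
      simp only [AffineMap.lineMap_apply, vsub_eq_sub, vadd_eq_add, Complex.add_im, Complex.add_re,
        Complex.real_smul, Complex.mul_im, Complex.mul_re, Complex.ofReal_re, Complex.ofReal_im,
        Complex.sub_re, Complex.sub_im, ← h, h1]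
      · ring
      · field_simp; ring

namespace OrthoData

open Relation

variable {V : Type*} {G : SimpleGraph V} {Φ : Type*} [Fintype V] [DecidableRel G.Adj]
  [DecidableEq Φ] {S : OrthoData G Φ} {X X' : ℝ}

/-- Heights compatible with the vertical orders on all lines give a planar drawing. -/
theorem Valid.isPlanarDrawing (hS : S.Valid) (hconn : G.Connected) {y : V → ℝ}
    (hy0 : ∀ d : G.Dart, S.dir d = 0 → y d.fst = y d.snd)
    (hy : ∀ X u v, S.Place X u → S.Place X v → TransGen (S.Cover X) u v → y u < y v) :
    IsPlanarDrawing (⊤ : G.Subgraph) (fun v => (⟨S.x v, y v⟩ : ℂ)) := by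
  have hcov : ∀ d : G.Dart, S.dir d = 1 → S.Cover (S.x d.fst) d.fst d.snd := fun d hd =>
    Or.inl ⟨d, rfl, rfl, hd, rfl⟩
  have hy1 : ∀ d : G.Dart, S.dir d = 1 → y d.fst < y d.snd := fun d hd =>
    hy _ _ _ (hS.cover_place (hcov d hd)).1 (hS.cover_place (hcov d hd)).2 (.single (hcov d hd))
  have hmem0 : ∀ d : G.Dart, S.dir d = 0 → ∀ z : ℂ,
      z ∈ openSegment ℝ (⟨S.x d.fst, y d.fst⟩ : ℂ) ⟨S.x d.snd, y d.snd⟩ ↔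
        z.im = y d.fst ∧ S.x d.fst < z.re ∧ z.re < S.x d.snd := fun d hd z =>
    mem_openSegment_iff_of_im_eq (hy0 d hd) (hS.x_right d hd)
  have hmem1 : ∀ d : G.Dart, S.dir d = 1 → ∀ z : ℂ,
      z ∈ openSegment ℝ (⟨S.x d.fst, y d.fst⟩ : ℂ) ⟨S.x d.snd, y d.snd⟩ ↔
        z.re = S.x d.fst ∧ y d.fst < z.im ∧ z.im < y d.snd := fun d hd z =>
    mem_openSegment_iff_of_re_eq (hS.x_up d hd) (hy1 d hd)
  have hpl : ∀ d : G.Dart, S.dir d = 0 → ∀ Z, S.x d.fst < Z → Z < S.x d.snd → S.Place Z d.fst :=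
    fun d hd Z h1 h2 => Or.inr ⟨h1, d, rfl, hd, h2⟩
  refine ⟨?_, ?_, ?_⟩
  · intro u _ v _ h
    have h1 : S.x u = S.x v := congrArg Complex.re h
    exact hS.eq_of_height_eq hconn hy (Or.inl h1) (Or.inl rfl) (congrArg Complex.im h)
  · have key : ∀ (d : G.Dart) (v : V), (⟨S.x v, y v⟩ : ℂ) ∉
        openSegment ℝ (⟨S.x d.fst, y d.fst⟩ : ℂ) ⟨S.x d.snd, y d.snd⟩ := by
      intro d v
      wlog h : S.dir d = 0 ∨ S.dir d = 1 generalizing d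
      · rw [openSegment_symm]
        exact this d.symm ((hS.dir_cases d).resolve_left h)
      intro hv
      rcases h with h | h
      · rw [hmem0 d h] at hv
        obtain ⟨h1, h2, h3⟩ := hv
        -- The vertex and the edge are two places of one line at the same height, hence equal.
        have := hS.eq_of_height_eq hconn hy (Or.inl rfl) (hpl d h _ h2 h3) h1
        subst this
        exact lt_irrefl _ h2
      · rw [hmem1 d h] at hv
        exact hS.not_between_of_cover hconn hy (hcov d h) (Or.inl hv.1) hv.2.1 hv.2.2
    intro a b v hab _
    exact key ⟨(a, b), hab⟩ v
  -- Consider the vertical line through a common point. Two horizontal edges are places of equal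
  -- height. A horizontal edge meeting a vertical one is a place strictly between the ends of a
  -- cover, and so is the higher of the lower ends of two vertical edges unless these coincide.
  · have key : ∀ (d e : G.Dart) (z : ℂ),
        z ∈ openSegment ℝ (⟨S.x d.fst, y d.fst⟩ : ℂ) ⟨S.x d.snd, y d.snd⟩ →
        z ∈ openSegment ℝ (⟨S.x e.fst, y e.fst⟩ : ℂ) ⟨S.x e.snd, y e.snd⟩ → d.edge = e.edge := by
      intro d e z hd he
      wlog h : S.dir d = 0 ∨ S.dir d = 1 generalizing d
      · rw [openSegment_symm] at hd
        exact d.edge_symm.symm.trans (this d.symm hd ((hS.dir_cases d).resolve_left h))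
      wlog h' : S.dir e = 0 ∨ S.dir e = 1 generalizing e
      · rw [openSegment_symm] at he
        exact (this e.symm he ((hS.dir_cases e).resolve_left h')).trans e.edge_symm
      rcases h with h | h <;> rcases h' with h' | h'
      · rw [hmem0 _ h] at hd
        rw [hmem0 _ h'] at he
        have := hS.eq_of_height_eq hconn hy (hpl d h _ hd.2.1 hd.2.2) (hpl e h' _ he.2.1 he.2.2)
          (hd.1.symm.trans he.1)
        rw [hS.fst_inj this (h.trans h'.symm)]
      · rw [hmem0 _ h] at hd
        rw [hmem1 _ h'] at he
        rw [he.1] at hd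
        exact (hS.not_between_of_cover hconn hy (hcov e h') (hpl d h _ hd.2.1 hd.2.2)
          (by linarith) (by linarith)).elim
      · rw [hmem1 _ h] at hd
        rw [hmem0 _ h'] at he
        rw [hd.1] at he
        exact (hS.not_between_of_cover hconn hy (hcov d h) (hpl e h' _ he.2.1 he.2.2)
          (by linarith) (by linarith)).elim
      · rw [hmem1 _ h] at hd
        rw [hmem1 _ h'] at he
        have hx : S.x d.fst = S.x e.fst := hd.1.symm.trans he.1
        rcases lt_trichotomy (y d.fst) (y e.fst) with hlt | heq | hlt
        · exact (hS.not_between_of_cover hconn hy (hcov d h) (Or.inl hx.symm) hlt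
            (by linarith)).elim
        · have := hS.eq_of_height_eq hconn hy (Or.inl hx) (Or.inl rfl) heq
          rw [hS.fst_inj this (h.trans h'.symm)]
        · exact (hS.not_between_of_cover hconn hy (hcov e h') (Or.inl hx) hlt
            (by linarith)).elim
    intro a b c d hab hcd hne
    rw [Set.disjoint_left]
    intro z hz hz'
    exact hne (key ⟨(a, b), hab⟩ ⟨(c, d), hcd⟩ z hz hz')

end OrthoData

/-! ### Directions and affine changes of a drawing -/

/-- The complex number `z` points in the direction `k`, in right angles from the positive real
axis. -/
def IsDir (z : ℂ) (k : ZMod 4) : Prop := ∃ r : ℝ, 0 < r ∧ z = r * Complex.I ^ k.val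

namespace IsDir

open Complex

theorem I_pow_val_add (k : ZMod 4) (n : ℕ) : I ^ (k + n : ZMod 4).val = I ^ k.val * I ^ n := by
  rw [← pow_add, ZMod.val_add, ZMod.val_natCast, Nat.add_mod_mod, ← Complex.I_pow_eq_pow_mod]

theorem iff_cases {z : ℂ} {k : ZMod 4} : IsDir z k ↔
    (k = 0 ∧ 0 < z.re ∧ z.im = 0) ∨ (k = 1 ∧ z.re = 0 ∧ 0 < z.im) ∨
    (k = 2 ∧ z.re < 0 ∧ z.im = 0) ∨ (k = 3 ∧ z.re = 0 ∧ z.im < 0) := by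
  have v0 : (0 : ZMod 4).val = 0 := rfl
  have v1 : (1 : ZMod 4).val = 1 := rfl
  have v2 : (2 : ZMod 4).val = 2 := rfl
  have v3 : (3 : ZMod 4).val = 3 := rfl
  constructor
  · rintro ⟨r, hr, rfl⟩
    rcases OrthoData.zmod4_cases k with rfl | rfl | rfl | rfl
    · left; simp [v0, hr]
    · right; left; simp [v1, hr]
    · right; right; left; simp [v2, hr]
    · right; right; right; simp [v3, hr, I_pow_three]
  · rintro (⟨rfl, h, h'⟩ | ⟨rfl, h, h'⟩ | ⟨rfl, h, h'⟩ | ⟨rfl, h, h'⟩)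
    · exact ⟨z.re, h, by apply Complex.ext <;> simp [v0, h']⟩
    · exact ⟨z.im, h', by apply Complex.ext <;> simp [v1, h]⟩
    · exact ⟨-z.re, by linarith, by apply Complex.ext <;> simp [v2, h']⟩
    · exact ⟨-z.im, by linarith, by apply Complex.ext <;> simp [v3, h, I_pow_three]⟩

theorem unique {z : ℂ} {k l : ZMod 4} (h : IsDir z k) (h' : IsDir z l) : k = l := by
  rw [iff_cases] at h h'
  rcases h with ⟨rfl, h1, h2⟩ | ⟨rfl, h1, h2⟩ | ⟨rfl, h1, h2⟩ | ⟨rfl, h1, h2⟩ <;>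
  rcases h' with ⟨rfl, h3, h4⟩ | ⟨rfl, h3, h4⟩ | ⟨rfl, h3, h4⟩ | ⟨rfl, h3, h4⟩ <;>
  first | rfl | (exfalso; linarith)

theorem mul {z : ℂ} {k : ZMod 4} (h : IsDir z k) {c : ℝ} (hc : 0 < c) (n : ℕ) :
    IsDir (c * I ^ n * z) (k + n) := by
  obtain ⟨r, hr, rfl⟩ := h
  refine ⟨c * r, mul_pos hc hr, ?_⟩
  rw [I_pow_val_add]
  push_cast
  ring

theorem exists_eq_mul {z w : ℂ} {k : ZMod 4} {n : ℕ} (hz : IsDir z k) (hw : IsDir w (k + n)) :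
    ∃ c : ℝ, 0 < c ∧ w = c * I ^ n * z := by
  obtain ⟨r, hr, rfl⟩ := hz
  obtain ⟨r', hr', rfl⟩ := hw
  refine ⟨r' / r, div_pos hr' hr, ?_⟩
  rw [I_pow_val_add]
  push_cast
  have : (r : ℂ) ≠ 0 := by exact_mod_cast hr.ne'
  field_simp

theorem neg {z : ℂ} {k : ZMod 4} (h : IsDir z k) : IsDir (-z) (k + 2) := by
  have := h.mul one_pos 2
  simpa using this

theorem eq_of_norm_eq {z w : ℂ} {k : ZMod 4} (hz : IsDir z k) (hw : IsDir w k)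
    (h : ‖z‖ = ‖w‖) : z = w := by
  obtain ⟨r, hr, rfl⟩ := hz
  obtain ⟨r', hr', rfl⟩ := hw
  simp only [norm_mul, norm_real, norm_pow, norm_I, one_pow, mul_one, Real.norm_eq_abs,
    abs_of_pos hr, abs_of_pos hr'] at h
  rw [h]

end IsDir

theorem openSegment_mul_add (s t a b : ℂ) :
    openSegment ℝ (s * a + t) (s * b + t) = (fun z => s * z + t) '' openSegment ℝ a b := by
  ext z
  constructor
  · rintro ⟨α, β, hα, hβ, h, rfl⟩
    refine ⟨_, ⟨α, β, hα, hβ, h, rfl⟩, ?_⟩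
    have h' : (α : ℂ) + β = 1 := by exact_mod_cast h
    simp only [Complex.real_smul]
    linear_combination (-t) * h'
  · rintro ⟨_, ⟨α, β, hα, hβ, h, rfl⟩, rfl⟩
    refine ⟨α, β, hα, hβ, h, ?_⟩
    have h' : (α : ℂ) + β = 1 := by exact_mod_cast h
    simp only [Complex.real_smul]
    linear_combination t * h'

theorem IsPlanarDrawing.mul_add {V : Type*} {G : SimpleGraph V} {H : G.Subgraph} {p p' : V → ℂ}
    (hp : IsPlanarDrawing H p) {s t : ℂ} (hs : s ≠ 0)
    (h : ∀ v ∈ H.verts, p' v = s * p v + t) : IsPlanarDrawing H p' := by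
  have hinj : Function.Injective (fun z : ℂ => s * z + t) := fun z w hzw => by
    simpa [hs] using hzw
  refine ⟨fun u hu v hv huv => ?_, fun a b v hab hv => ?_, fun a b c d hab hcd hne => ?_⟩
  · rw [h u hu, h v hv] at huv
    exact hp.injOn hu hv (hinj huv)
  · rw [h v hv, h a hab.fst_mem, h b hab.snd_mem, openSegment_mul_add]
    rintro ⟨z, hz, hzv⟩
    rw [hinj hzv] at hz
    exact hp.notMem_edge a b v hab hv hz
  · rw [h a hab.fst_mem, h b hab.snd_mem, h c hcd.fst_mem, h d hcd.snd_mem,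
      openSegment_mul_add, openSegment_mul_add]
    exact Set.disjoint_image_of_injective hinj (hp.disjoint a b c d hab hcd hne)

/-! ### Boundary walks, corners, and data from aligned face drawings -/

namespace RotationSystem

open SimpleGraph

variable {V : Type*} {G : SimpleGraph V} {R : RotationSystem G}

theorem boundary_adj {F : R.Face} {d : G.Dart}
    (h : R.faceOf d = F ∨ R.faceOf d.symm = F) : F.boundary.Adj d.fst d.snd := by
  rcases h with h | h
  · exact ⟨d, h, rfl⟩
  · exact ⟨d.symm, h, d.edge_symm⟩

theorem mem_boundary_verts {F : R.Face} {v : V} :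
    v ∈ F.boundary.verts ↔ ∃ d : G.Dart, R.faceOf d = F ∧ d.fst = v := by
  constructor
  · rintro ⟨d, hd, hv⟩
    rcases Sym2.mem_iff.1 (show v ∈ s(d.fst, d.snd) from hv) with rfl | rfl
    · exact ⟨d, hd, rfl⟩
    · exact ⟨R.faceNext d, (R.faceOf_faceNext d).trans hd, R.faceNext_fst d⟩
  · rintro ⟨d, hd, rfl⟩
    exact ⟨d, hd, Sym2.mem_mk_left d.fst d.snd⟩

/-- The boundary walk is a single cycle of `R.faceNext`, and it visits every vertex of the boundary.
-/
theorem eq_of_mem_boundary {α : Type*} {F : R.Face} {f : V → α}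
    (hf : ∀ d : G.Dart, R.faceOf d = F → f d.fst = f d.snd) {u v : V}
    (hu : u ∈ F.boundary.verts) (hv : v ∈ F.boundary.verts) : f u = f v := by
  obtain ⟨d, rfl, rfl⟩ := mem_boundary_verts.1 hu
  obtain ⟨e, he, rfl⟩ := mem_boundary_verts.1 hv
  obtain ⟨n, rfl⟩ : R.faceNext.SameCycle e d := Quotient.exact he
  have key : ∀ n : ℤ, ∀ c, R.faceOf c = R.faceOf e →
      f ((R.faceNext ^ n) c).fst = f c.fst := by
    intro n
    induction n with
    | zero => simp
    | succ n ih =>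
      intro c hc
      rw [zpow_add_one, Equiv.Perm.mul_apply, ih _ ((R.faceOf_faceNext c).trans hc),
        R.faceNext_fst, hf c (hc.trans he)]
    | pred n ih =>
      intro c hc
      have h1 : R.faceNext (R.faceNext⁻¹ c) = c := by
        rw [Equiv.Perm.coe_inv, Equiv.apply_symm_apply]
      have h2 : R.faceOf (R.faceNext⁻¹ c) = R.faceOf e := by
        rw [← R.faceOf_faceNext, h1, hc]
      rw [zpow_sub_one, Equiv.Perm.mul_apply, ih _ h2, hf _ (h2.trans he), ← R.faceNext_fst, h1]
  exact key n e rfl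

variable [Fintype V] [DecidableEq V] [DecidableRel G.Adj]

/-- The sum telescopes around the closed boundary walk. -/
theorem sum_face_eq_zero {α : Type*} [AddCommGroup α] [DecidableEq R.Face] (F : R.Face)
    (f : V → α) : ∑ d : G.Dart, (if R.faceOf d = F then f d.fst - f d.snd else 0) = 0 := by
  have h : ∑ d : G.Dart, (if R.faceOf d = F then f d.snd else 0)
      = ∑ d : G.Dart, (if R.faceOf d = F then f d.fst else 0) := by
    rw [← Equiv.sum_comp R.faceNext fun d => if R.faceOf d = F then f d.fst else 0]
    simp only [faceOf_faceNext, faceNext_fst]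
  refine Eq.trans ?_ (sub_eq_zero.2 h.symm)
  rw [← Finset.sum_sub_distrib]
  refine Finset.sum_congr rfl fun d _ => ?_
  split_ifs <;> simp

section Corner

variable {angle : G.Dart → ℕ} {dir : G.Dart → ZMod 4}

/-- The corners of a vertex with total angle four, in right angles, tile its four quadrants. -/
theorem corner_bijective (hpos : ∀ d, 0 < angle d) {v : V}
    (hangle : ∑ d : G.Dart with d.fst = v, angle d = 4) (hv : ∃ d : G.Dart, d.fst = v)
    (hrot : ∀ d, dir (R.rot d) = dir d + angle d) :
    Function.Bijective (fun c : (Σ d : {d : G.Dart // d.fst = v}, Fin (angle d)) =>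
      dir c.1 + (c.2 : ℕ)) := by
  rw [Fintype.bijective_iff_surjective_and_card]
  constructor
  · intro k
    obtain ⟨d₀, hd₀⟩ := hv
    -- Counting right angles counterclockwise from `d₀`, one stays in the corner or enters the next
    -- one. As there are four quadrants and the angles sum to four, surjectivity suffices.
    have key : ∀ n : ℕ, ∃ c : (Σ d : {d : G.Dart // d.fst = v}, Fin (angle d)),
        dir c.1 + (c.2 : ℕ) = dir d₀ + n := by
      intro n
      induction n with
      | zero => exact ⟨⟨⟨d₀, hd₀⟩, ⟨0, hpos _⟩⟩, by simp⟩
      | succ n ih =>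
        obtain ⟨⟨⟨d, hd⟩, ⟨j, hj⟩⟩, h⟩ := ih
        simp only at h hj
        by_cases hj' : j + 1 < angle d
        · exact ⟨⟨⟨d, hd⟩, ⟨j + 1, hj'⟩⟩, by push_cast; rw [← add_assoc, h, add_assoc]⟩
        · refine ⟨⟨⟨R.rot d, (R.rot_fst d).trans hd⟩, ⟨0, hpos _⟩⟩, ?_⟩
          have : angle d = j + 1 := by omega
          simp only [hrot, this]
          push_cast
          rw [add_zero, ← add_assoc, h, add_assoc]
    obtain ⟨c, hc⟩ := key (k - dir d₀).val
    exact ⟨c, hc.trans (by rw [ZMod.natCast_zmod_val, add_sub_cancel])⟩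
  · rw [Fintype.card_sigma, ZMod.card]
    simp only [Fintype.card_fin]
    rw [← hangle, ← Finset.sum_subtype (Finset.univ.filter fun d : G.Dart => d.fst = v)
      (fun d => by simp) angle]

theorem exists_corner (hpos : ∀ d, 0 < angle d)
    (hangle : ∀ v, ∑ d : G.Dart with d.fst = v, angle d = 4)
    (hv : ∀ v, ∃ d : G.Dart, d.fst = v)
    (hrot : ∀ d, dir (R.rot d) = dir d + angle d) (v : V) (k : ZMod 4) :
    ∃ d : G.Dart, d.fst = v ∧ ∃ j < angle d, dir d + (j : ℕ) = k := by
  obtain ⟨c, hc⟩ := (corner_bijective hpos (hangle v) (hv v) hrot).2 k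
  exact ⟨c.1, c.1.2, c.2, c.2.2, hc⟩

theorem corner_unique (hpos : ∀ d, 0 < angle d)
    (hangle : ∀ v, ∑ d : G.Dart with d.fst = v, angle d = 4)
    (hrot : ∀ d, dir (R.rot d) = dir d + angle d) {d e : G.Dart} (h : d.fst = e.fst) {i j : ℕ}
    (hi : i < angle d) (hj : j < angle e) (hij : dir d + i = dir e + j) : d = e := by
  have := @(corner_bijective hpos (hangle e.fst) ⟨e, rfl⟩ hrot).1 ⟨⟨d, h⟩, ⟨i, hi⟩⟩
    ⟨⟨e, rfl⟩, ⟨j, hj⟩⟩ hij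
  exact congrArg (fun c => (c.1 : G.Dart)) this

open Classical in
/-- Compatible drawings of the faces give valid data. -/
theorem exists_valid (hpos : ∀ d, 0 < angle d)
    (hangle : ∀ v, ∑ d : G.Dart with d.fst = v, angle d = 4)
    (hv : ∀ v, ∃ d : G.Dart, d.fst = v)
    (hrot : ∀ d, dir (R.rot d) = dir d + angle d) (hsymm : ∀ d, dir d.symm = dir d + 2)
    (x : V → ℝ) (y : R.Face → V → ℝ)
    (hdir : ∀ d : G.Dart, IsDir ((⟨x d.snd, y (R.faceOf d) d.snd⟩ : ℂ)
      - ⟨x d.fst, y (R.faceOf d) d.fst⟩) (dir d))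
    (hplanar : ∀ F : R.Face, IsPlanarDrawing F.boundary fun v => (⟨x v, y F v⟩ : ℂ)) :
    ∃ S : OrthoData G R.Face, S.Valid ∧ S.dir = dir ∧ S.x = x ∧ S.y = y := by
  choose corner hfst hcorner using exists_corner hpos hangle hv hrot
  have hcu : ∀ (d : G.Dart) (j : ℕ), j < angle d → corner d.fst (dir d + j) = d := by
    intro d j hj
    obtain ⟨i, hi, h⟩ := hcorner d.fst (dir d + j)
    exact corner_unique hpos hangle hrot (hfst _ _) hi hj h
  -- Each quadrant at a vertex gets the face of the corner that contains it.
  let S : OrthoData G R.Face := ⟨dir, fun v k => R.faceOf (corner v k), x, y⟩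
  have hleft : ∀ d, S.left d = R.faceOf d := fun d => by
    have := hcu d 0 (hpos d)
    rw [Nat.cast_zero, add_zero] at this
    exact congrArg R.faceOf this
  have hinc : ∀ {F d}, S.Inc F d → R.faceOf d = F ∨ R.faceOf d.symm = F := fun {F d} h => by
    rwa [OrthoData.Inc, hleft, hleft] at h
  have hadj : ∀ {F d}, S.Inc F d → F.boundary.Adj d.fst d.snd := fun h => boundary_adj (hinc h)
  have hon : ∀ {F v}, S.On F v → v ∈ F.boundary.verts := by
    rintro F v ⟨k, hk⟩
    exact mem_boundary_verts.2 ⟨_, hk, hfst v k⟩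
  have hdir' : ∀ {F d}, S.Inc F d →
      IsDir ((⟨x d.snd, y F d.snd⟩ : ℂ) - ⟨x d.fst, y F d.fst⟩) (dir d) := by
    intro F d h
    rcases hinc h with rfl | rfl
    · exact hdir d
    · have := (hdir d.symm).neg
      rw [hsymm, neg_sub, add_assoc, show (2 + 2 : ZMod 4) = 0 from rfl, add_zero] at this
      exact this
  have h0 : ∀ {F d}, dir d = 0 → S.Inc F d → x d.fst < x d.snd ∧ y F d.fst = y F d.snd := by
    intro F d hd hi
    have := hdir' hi
    rw [hd, IsDir.iff_cases] at this
    simp only [Complex.sub_re, Complex.sub_im] at this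
    rcases this with ⟨-, h, h'⟩ | ⟨h, -⟩ | ⟨h, -⟩ | ⟨h, -⟩
    · exact ⟨by linarith, by linarith⟩
    all_goals exact absurd h (by decide)
  have h1 : ∀ {F d}, dir d = 1 → S.Inc F d → x d.fst = x d.snd ∧ y F d.fst < y F d.snd := by
    intro F d hd hi
    have := hdir' hi
    rw [hd, IsDir.iff_cases] at this
    simp only [Complex.sub_re, Complex.sub_im] at this
    rcases this with ⟨h, -⟩ | ⟨-, h, h'⟩ | ⟨h, -⟩ | ⟨h, -⟩
    · exact absurd h (by decide)
    · exact ⟨by linarith, by linarith⟩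
    all_goals exact absurd h (by decide)
  have hi : ∀ d, S.Inc (R.faceOf d) d := fun d => Or.inl (hleft d)
  have m0 : ∀ {F d}, dir d = 0 → S.Inc F d → ∀ a b, a = y F d.fst → x d.fst < b → b < x d.snd →
      (⟨b, a⟩ : ℂ) ∈ openSegment ℝ (⟨x d.fst, y F d.fst⟩ : ℂ) ⟨x d.snd, y F d.snd⟩ :=
    fun hd hi a b h h' h'' =>
      (mem_openSegment_iff_of_im_eq (h0 hd hi).2 (h0 hd hi).1).2 ⟨h, h', h''⟩
  have m1 : ∀ {F d}, dir d = 1 → S.Inc F d → ∀ a b, b = x d.fst → y F d.fst < a →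
      a < y F d.snd → (⟨b, a⟩ : ℂ) ∈
        openSegment ℝ (⟨x d.fst, y F d.fst⟩ : ℂ) ⟨x d.snd, y F d.snd⟩ :=
    fun hd hi a b h h' h'' =>
      (mem_openSegment_iff_of_re_eq (h1 hd hi).1 (h1 hd hi).2).2 ⟨h, h', h''⟩
  refine ⟨S, ⟨hsymm, ?_, ?_, ?_, ?_, ?_, fun d hd => (h0 hd (hi d)).1,
    fun d hd => (h1 hd (hi d)).1, fun F d hd hi => (h0 hd hi).2, fun F d hd hi => (h1 hd hi).2,
    ?_, ?_, ?_, ?_⟩, rfl, rfl, rfl⟩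
  · intro d e h h'
    exact corner_unique hpos hangle hrot h (hpos d) (hpos e) (by simpa using h')
  · intro d
    rw [hleft]
    obtain ⟨e, rfl⟩ := R.rot.surjective d
    rw [faceOf_symm_rot]
    have h := hpos e
    -- The quadrant clockwise of `R.rot e` is the last one of the corner that begins at `e`.
    have := hcu e (angle e - 1) (by omega)
    have h' : dir e + ((angle e - 1 : ℕ) : ZMod 4) = dir (R.rot e) - 1 := by
      rw [hrot, Nat.cast_sub h, Nat.cast_one, add_sub_assoc]
    rw [h'] at this
    change _ = R.faceOf (corner (R.rot e).fst (dir (R.rot e) - 1))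
    rw [R.rot_fst, this]
  · intro v k hk
    obtain ⟨j, hj, h⟩ := hcorner v k
    -- Without an edge in direction `k`, the quadrant `k` is not the first of its corner, so the
    -- quadrant `k - 1` belongs to the same corner.
    have hj0 : j ≠ 0 := by
      rintro rfl
      exact hk _ (hfst v k) (by simpa using h)
    have := hcu (corner v k) (j - 1) (by omega)
    have h' : dir (corner v k) + ((j - 1 : ℕ) : ZMod 4) = k - 1 := by
      rw [Nat.cast_sub (by omega), Nat.cast_one, ← add_sub_assoc, h]
    rw [h', hfst] at this
    change R.faceOf _ = R.faceOf _
    rw [this]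
  · intro F g
    simp only [hleft]
    exact sum_face_eq_zero F g
  · intro F g hg u v hu hv
    exact eq_of_mem_boundary (fun d hd => hg d ((hleft d).trans hd)) (hon hu) (hon hv)
  · intro F u v hu hv hx hy
    exact (hplanar F).injOn (hon hu) (hon hv) (Complex.ext hx hy)
  · intro F d v hd hi hv hy hx hx'
    exact (hplanar F).notMem_edge _ _ v (hadj hi) (hon hv) (m0 hd hi _ _ hy hx hx')
  · intro F d v hd hi hv hx hy hy'
    exact (hplanar F).notMem_edge _ _ v (hadj hi) (hon hv) (m1 hd hi _ _ hx hy hy')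
  · intro F d e hd he hid hie hx hx' hy hy'
    have hne : s(d.fst, d.snd) ≠ s(e.fst, e.snd) := by
      intro h
      rcases (dart_edge_eq_iff d e).1 h with rfl | rfl
      · exact lt_irrefl _ hx
      · exact lt_irrefl _ hx'
    exact Set.disjoint_left.1 ((hplanar F).disjoint _ _ _ _ (hadj hid) (hadj hie) hne)
      (m0 hd hid _ _ rfl hx hx') (m1 he hie _ _ rfl hy hy')

end Corner

end RotationSystem

/-! ### Aligning the face drawings -/

/-- The inclusion of `ZMod 2` in `ZMod 4`. -/
def halfTurn : ZMod 2 →+ ZMod 4 where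
  toFun g := if g = 0 then 0 else 2
  map_zero' := rfl
  map_add' := by decide

namespace RotationSystem

open SimpleGraph

variable {V : Type*} {G : SimpleGraph V} {R : RotationSystem G} {angle : G.Dart → ℕ}
  {hor : Set (Sym2 V)} {len : Sym2 V → ℝ}

theorem _root_.DrawsFace.exists_isDir {F : R.Face} {p : V → ℂ}
    (hp : DrawsFace R angle hor len F p) {d : G.Dart}
    (h : R.faceOf d = F ∨ R.faceOf d.symm = F) :
    ∃ k, IsDir (p d.snd - p d.fst) k ∧ (d.edge ∈ hor ↔ k = 0 ∨ k = 2) := by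
  have hadj := boundary_adj h
  have hne : p d.fst ≠ p d.snd := fun h =>
    d.fst_ne_snd (hp.planar.injOn hadj.fst_mem hadj.snd_mem h)
  by_cases hh : d.edge ∈ hor
  · have him := (hp.horizontal _ _ hadj hh).1
    have hre : (p d.fst).re ≠ (p d.snd).re := fun h => hne (Complex.ext h him)
    rcases hre.lt_or_gt with h | h
    · exact ⟨0, IsDir.iff_cases.2 (Or.inl ⟨rfl, by simpa, by simp [him]⟩), by simp [hh]⟩
    · exact ⟨2, IsDir.iff_cases.2 (Or.inr (Or.inr (Or.inl ⟨rfl, by simpa, by simp [him]⟩))),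
        by simp [hh]⟩
  · have hre := hp.vertical _ _ hadj hh
    have him : (p d.fst).im ≠ (p d.snd).im := fun h => hne (Complex.ext hre h)
    rcases him.lt_or_gt with h | h
    · refine ⟨1, IsDir.iff_cases.2 (Or.inr (Or.inl ⟨rfl, by simp [hre], by simpa⟩)), ?_⟩
      simp only [hh, false_iff]; decide
    · refine ⟨3, IsDir.iff_cases.2 (Or.inr (Or.inr (Or.inr ⟨rfl, by simp [hre], by simpa⟩))), ?_⟩
      simp only [hh, false_iff]; decide

/-- An angle zero between distinct edges would make them overlap in the drawing of their face. A
dart that is its own successor is alone at its vertex and has angle four. -/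
theorem angle_pos [Fintype V] [DecidableEq V] [DecidableRel G.Adj] {q : R.Face → V → ℂ}
    (hq : ∀ F, DrawsFace R angle hor len F (q F))
    (hangle : ∀ v, (∃ d : G.Dart, d.fst = v) → ∑ d : G.Dart with d.fst = v, angle d = 4)
    (d : G.Dart) : 0 < angle d := by
  by_contra! h0
  replace h0 : angle d = 0 := by omega
  by_cases hd : R.rot d = d
  · have h := hangle d.fst ⟨d, rfl⟩
    rw [Finset.sum_eq_zero] at h
    · omega
    · intro e he
      have he' : e.fst = d.fst := (Finset.mem_filter.1 he).2
      have := R.eq_of_fst_eq (fun e => e = d) (fun e => by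
        rw [← Equiv.apply_eq_iff_eq R.rot (x := e), hd]) he'
      rw [show e = d by simpa using this, h0]
  · have hp := hq (R.faceOf d)
    obtain ⟨c, hc, h⟩ := hp.angles d rfl
    rw [h0, pow_zero, mul_one] at h
    have h1 := boundary_adj (R := R) (d := d) (Or.inl rfl)
    have h2 := boundary_adj (d := R.rot d) (Or.inr (R.faceOf_symm_rot d))
    have hne : s(d.fst, d.snd) ≠ s((R.rot d).fst, (R.rot d).snd) := by
      intro h
      rcases (dart_edge_eq_iff d (R.rot d)).1 h with h | h
      · exact hd h.symm
      · have h3 := congrArg (fun e : G.Dart => e.snd) h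
        have h4 : d.snd = d.fst := h3.trans (R.rot_fst d)
        exact d.snd_ne_fst h4
    rw [R.rot_fst] at h2 hne
    have hdisj := Set.disjoint_left.1 (hp.planar.disjoint _ _ _ _ h1 h2 hne)
    -- The edges are `z` and `c * z` from their common end; the point `c / (1 + c) * z` is interior
    -- to both, with parameters `c / (1 + c)` and `1 / (1 + c)`.
    refine @hdisj (q (R.faceOf d) d.fst +
        ((c / (1 + c) : ℝ) : ℂ) * (q (R.faceOf d) d.snd - q (R.faceOf d) d.fst)) ?_ ?_
    · refine ⟨1 / (1 + c), c / (1 + c), by positivity, by positivity, by field_simp, ?_⟩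
      simp only [Complex.real_smul]
      have : (1 + c : ℂ) ≠ 0 := by exact_mod_cast (by positivity : (1 + c : ℝ) ≠ 0)
      push_cast
      field_simp
      ring
    · refine ⟨c / (1 + c), 1 / (1 + c), by positivity, by positivity, by field_simp; ring, ?_⟩
      rw [eq_add_of_sub_eq h]
      simp only [Complex.real_smul]
      have : (1 + c : ℂ) ≠ 0 := by exact_mod_cast (by positivity : (1 + c : ℝ) ≠ 0)
      push_cast
      field_simp
      ring

variable [Fintype V] [DecidableEq V] [DecidableRel G.Adj]

/-- Drawings of all faces can be turned so that the directions of all darts agree. -/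
theorem IsPlane.exists_dir [Nonempty G.Dart] (hR : R.IsPlane) (hconn : G.Connected)
    (hangle : ∀ v, ∑ d : G.Dart with d.fst = v, angle d = 4)
    {q : R.Face → V → ℂ} (hq : ∀ F, DrawsFace R angle hor len F (q F)) :
    ∃ (dir : G.Dart → ZMod 4) (σ : R.Face → ℂ), (∀ F, σ F = 1 ∨ σ F = -1) ∧
      (∀ d, dir d.symm = dir d + 2) ∧ (∀ d, dir (R.rot d) = dir d + angle d) ∧
      (∀ d, d.edge ∈ hor ↔ dir d = 0 ∨ dir d = 2) ∧
      ∀ d, IsDir (σ (R.faceOf d) * (q (R.faceOf d) d.snd - q (R.faceOf d) d.fst)) (dir d) := by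
  have ha' := fun d : G.Dart => (hq (R.faceOf d)).exists_isDir (Or.inl rfl)
  choose a ha hahor using ha'
  have hb : ∀ d : G.Dart, IsDir (q (R.faceOf d.symm) d.snd - q (R.faceOf d.symm) d.fst)
      (a d.symm + 2) := fun d => by
    have := (ha d.symm).neg
    rwa [neg_sub] at this
  -- The direction of `d` in the drawing on its right is `a d.symm + 2`. Both drawings have the edge
  -- horizontal or both vertical, so they differ by a half-turn or not at all.
  have hg' : ∀ d, ∃ g : ZMod 2, a d.symm + 2 = a d + halfTurn g := by
    intro d
    have h1 := hahor d
    have h2 := hahor d.symm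
    rw [d.edge_symm, h1] at h2
    clear h1 hahor hb ha
    revert h2
    generalize a d = k
    generalize a d.symm = l
    revert k l
    decide
  choose g hg using hg'
  have hgs : ∀ d, g d.symm = - g d := by
    intro d
    have h1 := hg d
    have h2 := hg d.symm
    rw [d.symm_symm] at h2
    revert h1 h2
    generalize a d = k
    generalize a d.symm = l
    generalize g d = m
    generalize g d.symm = n
    revert k l m n
    decide
  have hrot : ∀ d, a (R.rot d).symm + 2 = a d + angle d := by
    intro d
    have h1 := hb (R.rot d)
    rw [R.faceOf_symm_rot] at h1
    obtain ⟨c, hc, h⟩ := (hq (R.faceOf d)).angles d rfl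
    rw [← R.rot_fst] at h
    rw [h, R.rot_fst] at h1
    exact h1.unique ((ha d).mul hc _)
  have hinj : ∀ m : ZMod 2, halfTurn m = 0 → m = 0 := by decide
  -- After reindexing by `R.rot`, the discrepancies around `v` add up to the sum of the angles,
  -- which is four, or zero modulo four.
  have hsum : ∀ v, ∑ d : G.Dart, (if d.fst = v then g d else 0) = 0 := by
    intro v
    apply hinj
    have h1 : ∑ d : G.Dart, (if d.fst = v then a (R.rot d).symm + 2 - a d else 0) = 0 := by
      have h2 : ∀ d, a (R.rot d).symm + 2 - a d = ((angle d : ℕ) : ZMod 4) := fun d => by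
        rw [hrot, add_sub_cancel_left]
      simp only [h2]
      rw [← Finset.sum_filter, ← Nat.cast_sum, hangle]
      rfl
    have h3 : ∑ d : G.Dart, (if d.fst = v then a (R.rot d).symm + 2 else 0)
        = ∑ d : G.Dart, (if d.fst = v then a d.symm + 2 else 0) := by
      rw [← Equiv.sum_comp R.rot fun d => if d.fst = v then a d.symm + 2 else 0]
      simp only [R.rot_fst]
    have h4 : ∀ (d : G.Dart) (A B : ZMod 4), (if d.fst = v then A - B else 0)
        = (if d.fst = v then A else 0) - if d.fst = v then B else 0 := by
      intro d A B; split_ifs <;> simp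
    rw [map_sum, ← h1]
    simp only [h4]
    rw [Finset.sum_sub_distrib, h3, ← Finset.sum_sub_distrib]
    refine Finset.sum_congr rfl fun d _ => ?_
    split_ifs
    · rw [hg, add_sub_cancel_left]
    · simp
  -- The face potential says which face drawings to turn: those with `s F ≠ 0`.
  obtain ⟨s, hs⟩ := hR.exists_face_potential hconn g hgs (by
    intro v
    convert hsum v)
  have hs' : ∀ d, a d.symm + 2 = a d + halfTurn (s (R.faceOf d) - s (R.faceOf d.symm)) :=
    fun d => by rw [← hs, hg]
  refine ⟨fun d => a d + halfTurn (s (R.faceOf d)), fun F => if s F = 0 then 1 else -1,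
    fun F => ?_, fun d => ?_, fun d => ?_, fun d => ?_, fun d => ?_⟩
  · beta_reduce
    split_ifs <;> simp
  · have h := hs' d
    beta_reduce
    revert h
    generalize a d = k
    generalize a d.symm = l
    generalize s (R.faceOf d) = m
    generalize s (R.faceOf d.symm) = n
    revert k l m n
    decide
  · have h := hs' (R.rot d)
    rw [hrot, R.faceOf_symm_rot] at h
    beta_reduce
    revert h
    generalize a d = k
    generalize a (R.rot d) = l
    generalize s (R.faceOf d) = m
    generalize s (R.faceOf (R.rot d)) = n
    generalize (angle d : ZMod 4) = o
    revert k l m n o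
    decide
  · beta_reduce
    rw [hahor]
    generalize a d = k
    generalize s (R.faceOf d) = m
    revert k m
    decide
  · beta_reduce
    by_cases h : s (R.faceOf d) = 0
    · rw [if_pos h, h, map_zero, add_zero, one_mul]
      exact ha d
    · rw [if_neg h, neg_one_mul]
      have : halfTurn (s (R.faceOf d)) = 2 := by
        revert h
        generalize s (R.faceOf d) = m
        revert m
        decide
      rw [this]
      exact (ha d).neg

/-- Heights compatible with the vertical orders give a drawing of the graph. -/
theorem drawsGraph_of_valid [DecidableEq R.Face] (hconn : G.Connected)
    {S : OrthoData G R.Face} (hS : S.Valid)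
    (hrot : ∀ d, S.dir (R.rot d) = S.dir d + angle d)
    (hhor : ∀ d : G.Dart, d.edge ∈ hor ↔ S.dir d = 0 ∨ S.dir d = 2)
    (hlen : ∀ d : G.Dart, d.edge ∈ hor → |S.x d.fst - S.x d.snd| = len d.edge) {y : V → ℝ}
    (hy0 : ∀ d : G.Dart, S.dir d = 0 → y d.fst = y d.snd)
    (hy : ∀ X u v, S.Place X u → S.Place X v → Relation.TransGen (S.Cover X) u v → y u < y v) :
    DrawsGraph R angle hor len (fun v => (⟨S.x v, y v⟩ : ℂ)) := by
  have hy1 : ∀ d : G.Dart, S.dir d = 1 → y d.fst < y d.snd := fun d hd => by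
    have hc : S.Cover (S.x d.fst) d.fst d.snd := Or.inl ⟨d, rfl, rfl, hd, rfl⟩
    exact hy _ _ _ (hS.cover_place hc).1 (hS.cover_place hc).2 (.single hc)
  have hdir : ∀ d : G.Dart,
      IsDir ((⟨S.x d.snd, y d.snd⟩ : ℂ) - ⟨S.x d.fst, y d.fst⟩) (S.dir d) := by
    have key : ∀ d : G.Dart, S.dir d = 0 ∨ S.dir d = 1 →
        IsDir ((⟨S.x d.snd, y d.snd⟩ : ℂ) - ⟨S.x d.fst, y d.fst⟩) (S.dir d) := by
      rintro d (h | h)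
      · exact IsDir.iff_cases.2 (Or.inl ⟨h, sub_pos.2 (hS.x_right d h),
          sub_eq_zero.2 (hy0 d h).symm⟩)
      · exact IsDir.iff_cases.2 (Or.inr (Or.inl ⟨h, sub_eq_zero.2 (hS.x_up d h).symm,
          sub_pos.2 (hy1 d h)⟩))
    intro d
    rcases hS.dir_cases d with h | h
    · exact key d h
    · have := (key d.symm h).neg
      rw [hS.dir_symm, neg_sub, add_assoc, show (2 + 2 : ZMod 4) = 0 from rfl, add_zero] at this
      exact this
  refine ⟨hS.isPlanarDrawing hconn hy0 hy, fun a b hab hh => ?_, fun a b hab hh => ?_,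
    fun d _ => ?_⟩
  · have hd := hdir ⟨(a, b), hab⟩
    refine ⟨?_, hlen ⟨(a, b), hab⟩ hh⟩
    have hk := (hhor ⟨(a, b), hab⟩).1 hh
    rw [IsDir.iff_cases] at hd
    simp only [Complex.sub_im] at hd
    rcases hk with hk | hk <;> rw [hk] at hd
    · rcases hd with ⟨-, -, h⟩ | ⟨h, -⟩ | ⟨h, -⟩ | ⟨h, -⟩
      · exact (sub_eq_zero.1 h).symm
      all_goals exact absurd h (by decide)
    · rcases hd with ⟨h, -⟩ | ⟨h, -⟩ | ⟨-, -, h⟩ | ⟨h, -⟩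
      · exact absurd h (by decide)
      · exact absurd h (by decide)
      · exact (sub_eq_zero.1 h).symm
      · exact absurd h (by decide)
  · have hd := hdir ⟨(a, b), hab⟩
    have hk := (not_congr (hhor ⟨(a, b), hab⟩)).1 hh
    rw [not_or] at hk
    rw [IsDir.iff_cases] at hd
    rcases hd with ⟨h, -⟩ | ⟨-, h, -⟩ | ⟨h, -⟩ | ⟨-, h, -⟩
    · exact (hk.1 h).elim
    · exact (sub_eq_zero.1 h).symm
    · exact (hk.2 h).elim
    · exact (sub_eq_zero.1 h).symm
  · have h := hdir (R.rot d)
    rw [hrot, R.rot_fst] at h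
    exact (hdir d).exists_eq_mul h

theorem _root_.IsPlanarDrawing.mono {H K : G.Subgraph} (h : H ≤ K) {p : V → ℂ}
    (hp : IsPlanarDrawing K p) : IsPlanarDrawing H p :=
  ⟨hp.injOn.mono h.1, fun a b v hab hv => hp.notMem_edge a b v (h.2 hab) (h.1 hv),
    fun a b c d hab hcd => hp.disjoint a b c d (h.2 hab) (h.2 hcd)⟩

theorem _root_.DrawsGraph.drawsFace {p : V → ℂ} (hp : DrawsGraph R angle hor len p)
    (F : R.Face) : DrawsFace R angle hor len F p :=
  ⟨hp.planar.mono le_top, fun a b hab => hp.horizontal a b hab.adj_sub,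
    fun a b hab => hp.vertical a b hab.adj_sub, fun d _ => hp.angles d (Set.mem_univ d)⟩

open Classical in
/-- A coordinate that changes along each edge by the same amount in both faces of the edge can be
chosen globally. -/
theorem IsPlane.exists_coordinate [Nonempty G.Dart] (hR : R.IsPlane) (hconn : G.Connected)
    (f : R.Face → V → ℝ) (hf : ∀ d : G.Dart, f (R.faceOf d) d.snd - f (R.faceOf d) d.fst
      = f (R.faceOf d.symm) d.snd - f (R.faceOf d.symm) d.fst) :
    ∃ (x : V → ℝ) (c : R.Face → ℝ), ∀ F : R.Face, ∀ v ∈ F.boundary.verts, x v = f F v + c F := by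
  obtain ⟨x, hx⟩ := hR.exists_vertex_potential hconn
    (fun d => f (R.faceOf d) d.snd - f (R.faceOf d) d.fst)
    (fun d => by
      rw [hf d, neg_sub]
      rfl)
    (fun F => by
      have h := sum_face_eq_zero F (fun v => - f F v)
      refine (Finset.sum_congr rfl fun d _ => ?_).trans h
      split_ifs with hd
      · rw [hd]; ring
      · rfl)
  have hc : ∀ F : R.Face, ∃ c, ∀ v ∈ F.boundary.verts, x v = f F v + c := by
    intro F
    induction F using Quotient.ind with
    | _ d =>
      refine ⟨x d.fst - f (R.faceOf d) d.fst, fun v hv => ?_⟩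
      have := eq_of_mem_boundary (F := R.faceOf d) (f := fun v => x v - f (R.faceOf d) v)
        (fun e he => by
          have h := hx e
          rw [he] at h
          linarith) hv (mem_boundary_verts.2 ⟨d, rfl, rfl⟩)
      change x v = f (R.faceOf d) v + _
      linarith
  choose c hc using hc
  exact ⟨x, c, hc⟩

open Classical in
/-- Drawings of the faces give valid data, with the abscissae of a drawing of the graph and, if
the vertical lengths agree too, with common ordinates. -/
theorem IsPlane.exists_valid_of_drawsFace [Nonempty G.Dart] (hR : R.IsPlane)
    (hconn : G.Connected) (hangle : ∀ v, ∑ d : G.Dart with d.fst = v, angle d = 4)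
    {q : R.Face → V → ℂ} (hq : ∀ F, DrawsFace R angle hor len F (q F)) :
    ∃ S : OrthoData G R.Face, S.Valid ∧ (∀ d, S.dir (R.rot d) = S.dir d + angle d) ∧
      (∀ d : G.Dart, d.edge ∈ hor ↔ S.dir d = 0 ∨ S.dir d = 2) ∧
      (∀ d : G.Dart, d.edge ∈ hor → |S.x d.fst - S.x d.snd| = len d.edge) ∧
      ((∀ d : G.Dart, d.edge ∉ hor → dist (q (R.faceOf d) d.fst) (q (R.faceOf d) d.snd)
          = dist (q (R.faceOf d.symm) d.fst) (q (R.faceOf d.symm) d.snd)) →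
        ∃ y : V → ℝ, (∀ F, S.y F = y) ∧ ∀ F : R.Face, ∃ s t : ℂ, (s = 1 ∨ s = -1) ∧
          ∀ v ∈ F.boundary.verts, (⟨S.x v, y v⟩ : ℂ) = s * q F v + t) := by
  obtain ⟨dir, σ, hσ, hsymm, hrot, hhor, hdir⟩ := hR.exists_dir hconn hangle hq
  have hσ0 : ∀ F, σ F ≠ 0 := fun F => by rcases hσ F with h | h <;> simp [h]
  have hσn : ∀ F, ‖σ F‖ = 1 := fun F => by rcases hσ F with h | h <;> simp [h]
  have hdir' : ∀ d : G.Dart, IsDir (σ (R.faceOf d.symm) * (q (R.faceOf d.symm) d.snd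
      - q (R.faceOf d.symm) d.fst)) (dir d) := fun d => by
    have := (hdir d.symm).neg
    rw [hsymm, ← mul_neg, neg_sub, add_assoc, show (2 + 2 : ZMod 4) = 0 from rfl, add_zero] at this
    exact this
  have hnorm : ∀ d : G.Dart, ∀ F, (R.faceOf d = F ∨ R.faceOf d.symm = F) → d.edge ∈ hor →
      ‖q F d.snd - q F d.fst‖ = len d.edge := by
    intro d F hF hd
    obtain ⟨h1, h2⟩ := (hq F).horizontal _ _ (boundary_adj hF) hd
    have : q F d.snd - q F d.fst = (((q F d.snd).re - (q F d.fst).re : ℝ) : ℂ) := by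
      apply Complex.ext <;> simp [h1]
    rw [this, Complex.norm_real, Real.norm_eq_abs, abs_sub_comm]
    exact h2
  have heq : ∀ d : G.Dart, ‖q (R.faceOf d) d.snd - q (R.faceOf d) d.fst‖
      = ‖q (R.faceOf d.symm) d.snd - q (R.faceOf d.symm) d.fst‖ →
      σ (R.faceOf d) * (q (R.faceOf d) d.snd - q (R.faceOf d) d.fst)
        = σ (R.faceOf d.symm) * (q (R.faceOf d.symm) d.snd - q (R.faceOf d.symm) d.fst) :=
    fun d h => (hdir d).eq_of_norm_eq (hdir' d) (by rw [norm_mul, norm_mul, hσn, hσn, h])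
  have hre0 : ∀ {z : ℂ} {d : G.Dart}, d.edge ∉ hor → IsDir z (dir d) → z.re = 0 := by
    intro z d hd hz
    rw [hhor, not_or] at hd
    rw [IsDir.iff_cases] at hz
    rcases hz with ⟨h, -⟩ | ⟨-, h, -⟩ | ⟨h, -⟩ | ⟨-, h, -⟩
    · exact (hd.1 h).elim
    · exact h
    · exact (hd.2 h).elim
    · exact h
  -- A horizontal edge has the same direction and length in both faces, hence the same displacement;
  -- a vertical edge has no horizontal displacement.
  obtain ⟨x, cx, hx⟩ := hR.exists_coordinate hconn (fun F v => (σ F * q F v).re) (fun d => by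
    rw [← Complex.sub_re, ← Complex.sub_re, ← mul_sub, ← mul_sub]
    by_cases hd : d.edge ∈ hor
    · rw [heq d ((hnorm d _ (Or.inl rfl) hd).trans (hnorm d _ (Or.inr rfl) hd).symm)]
    · rw [hre0 hd (hdir d), hre0 hd (hdir' d)])
  have main : ∀ (y : R.Face → V → ℝ) (cy : R.Face → ℝ),
      (∀ F : R.Face, ∀ v ∈ F.boundary.verts, y F v = (σ F * q F v).im + cy F) →
      ∃ S : OrthoData G R.Face, S.Valid ∧ S.dir = dir ∧ S.x = x ∧ S.y = y := by
    intro y cy hy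
    have hxy : ∀ F : R.Face, ∀ v ∈ F.boundary.verts,
        (⟨x v, y F v⟩ : ℂ) = σ F * q F v + ⟨cx F, cy F⟩ := fun F v hv =>
      Complex.ext (hx F v hv) (hy F v hv)
    exact exists_valid
      (angle_pos hq fun v _ => hangle v) hangle (exists_dart_of_fst hconn) hrot hsymm x y
      (fun d => by
        have h := boundary_adj (R := R) (d := d) (Or.inl rfl)
        rw [hxy _ _ h.fst_mem, hxy _ _ h.snd_mem, add_sub_add_right_eq_sub, ← mul_sub]
        exact hdir d)
      (fun F => (hq F).planar.mul_add (hσ0 F) (hxy F))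
  have hlen : ∀ d : G.Dart, d.edge ∈ hor → |x d.fst - x d.snd| = len d.edge := by
    intro d hd
    have h := boundary_adj (R := R) (d := d) (Or.inl rfl)
    rw [← hnorm d _ (Or.inl rfl) hd, hx _ _ h.fst_mem, hx _ _ h.snd_mem]
    have him := ((hq (R.faceOf d)).horizontal _ _ h hd).1
    rw [← one_mul ‖_‖, ← hσn (R.faceOf d), ← norm_mul, add_sub_add_right_eq_sub, abs_sub_comm,
      ← Complex.sub_re, ← mul_sub]
    have : (σ (R.faceOf d) * (q (R.faceOf d) d.snd - q (R.faceOf d) d.fst)).im = 0 := by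
      rcases hσ (R.faceOf d) with h | h <;> simp [h, him]
    exact Complex.abs_re_eq_norm.2 this
  by_cases hdist : ∀ d : G.Dart, d.edge ∉ hor →
      dist (q (R.faceOf d) d.fst) (q (R.faceOf d) d.snd)
        = dist (q (R.faceOf d.symm) d.fst) (q (R.faceOf d.symm) d.snd)
  · obtain ⟨y, cy, hy⟩ := hR.exists_coordinate hconn (fun F v => (σ F * q F v).im) (fun d => by
      rw [← Complex.sub_im, ← Complex.sub_im, ← mul_sub, ← mul_sub, heq d]
      by_cases hd : d.edge ∈ hor
      · exact (hnorm d _ (Or.inl rfl) hd).trans (hnorm d _ (Or.inr rfl) hd).symm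
      · have := hdist d hd
        rwa [_root_.dist_comm, _root_.dist_comm (q (R.faceOf d.symm) d.fst), dist_eq_norm,
          dist_eq_norm] at this)
    obtain ⟨S, h1, h2, h3, h4⟩ := main (fun _ => y) cy hy
    refine ⟨S, h1, by rwa [h2], by rwa [h2], by rwa [h3], fun _ => ⟨y, fun F => by rw [h4],
      fun F => ⟨σ F, ⟨cx F, cy F⟩, hσ F, fun v hv => ?_⟩⟩⟩
    rw [h3]
    exact Complex.ext (hx F v hv) (hy F v hv)
  -- If the vertical lengths disagree, each face keeps its own ordinates; validity compares
  -- ordinates only within one face.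
  · obtain ⟨S, h1, h2, h3, h4⟩ := main (fun F v => (σ F * q F v).im) 0 (by simp)
    exact ⟨S, h1, by rwa [h2], by rwa [h2], by rwa [h3], fun h => (hdist h).elim⟩

end RotationSystem

/-! ### Assembly -/

theorem mainTheorem6 {V : Type*} [Fintype V] [DecidableEq V] (G : SimpleGraph V)
    [DecidableRel G.Adj] (hconn : G.Connected) (hdeg : ∀ v, G.degree v ≤ 4)
    (R : RotationSystem G) (hplane : R.IsPlane)
    (angle : G.Dart → ℕ)
    (hangle : ∀ v, 0 < G.degree v → ∑ d : G.Dart with d.fst = v, angle d = 4)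
    (hor : Set (Sym2 V)) (len : Sym2 V → ℝ) :
    ((∃ p : V → ℂ, DrawsGraph R angle hor len p) ↔
      ∀ F : R.Face, ∃ q : V → ℂ, DrawsFace R angle hor len F q) ∧
    (∀ q : R.Face → V → ℂ,
      (∀ F, DrawsFace R angle hor len F (q F)) →
      (∀ d : G.Dart, d.edge ∉ hor →
        dist (q (R.faceOf d) d.fst) (q (R.faceOf d) d.snd)
          = dist (q (R.faceOf d.symm) d.fst) (q (R.faceOf d.symm) d.snd)) →
      ∃ p : V → ℂ, DrawsGraph R angle hor len p ∧
        ∀ F : R.Face, ∃ s t : ℂ, (s = 1 ∨ s = -1) ∧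
          ∀ v ∈ F.boundary.verts, p v = s * q F v + t) := by
  classical
  rcases isEmpty_or_nonempty G.Dart with hempty | hne
  -- A connected graph without edges is a single vertex, and `R.Face` is empty.
  · have hadj : ∀ a b, ¬ G.Adj a b := fun a b h => hempty.elim ⟨(a, b), h⟩
    have hsub : Subsingleton V := ⟨fun u v => by
      obtain ⟨p⟩ := hconn.preconnected u v
      cases p with
      | nil => rfl
      | cons h _ => exact (hadj _ _ h).elim⟩
    have hdraw : DrawsGraph R angle hor len (fun _ => 0) :=
      ⟨⟨fun u _ v _ _ => Subsingleton.elim u v, fun a b _ h => (hadj a b h).elim,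
        fun a b _ _ h => (hadj a b h).elim⟩, fun a b h => (hadj a b h).elim,
        fun a b h => (hadj a b h).elim, fun d => hempty.elim d⟩
    have hF : ∀ F : R.Face, False := fun F => by
      induction F using Quotient.ind with
      | _ d => exact hempty.elim d
    exact ⟨⟨fun _ F => (hF F).elim, fun _ => ⟨_, hdraw⟩⟩,
      fun _ _ _ => ⟨_, hdraw, fun F => (hF F).elim⟩⟩
  have hangle' : ∀ v, ∑ d : G.Dart with d.fst = v, angle d = 4 := by
    intro v
    obtain ⟨d, rfl⟩ := RotationSystem.exists_dart_of_fst hconn v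
    exact hangle _ ((G.degree_pos_iff_exists_adj _).2 ⟨_, d.adj⟩)
  refine ⟨⟨fun ⟨p, hp⟩ F => ⟨p, hp.drawsFace F⟩, fun h => ?_⟩, fun q hq hdist => ?_⟩
  · choose q hq using h
    obtain ⟨S, hS, hrot, hhor, hlen, -⟩ := hplane.exists_valid_of_drawsFace hconn hangle' hq
    obtain ⟨y, hy0, hy⟩ := hS.exists_height hconn
    exact ⟨_, RotationSystem.drawsGraph_of_valid hconn hS hrot hhor hlen hy0 hy⟩
  · obtain ⟨S, hS, hrot, hhor, hlen, h⟩ := hplane.exists_valid_of_drawsFace hconn hangle' hq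
    obtain ⟨y, hy, hst⟩ := h hdist
    refine ⟨_, RotationSystem.drawsGraph_of_valid hconn hS hrot hhor hlen (y := y) (fun d hd => ?_)
      (fun X u v _ _ h => hS.transGen_le (fun F v => congrFun (hy F) v) h), hst⟩
    have := hS.y_right _ d hd (Or.inl rfl)
    rwa [hy] at this
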